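/- Let $E$ be a measurable space, $\Pi$ a Markov kernel on $E$, $0<\alpha<1$, and let $f,g,h:E\to\mathbb{R}$ be measurable. Under $\mathbb{P}_x$, $x\in E$, let $X=(X_n)_{n\in\mathbb{N}_0}$ be a homogeneous Markov process with kernel $\Pi$ and $X_0=x$, and let $\xi^{(i)}_n$, $i=1,2$, $n\in\mathbb{N}_0$, be independent random variables, uniformly distributed on $(0,1)$ and independent of $X$. Let $\tilde X$ be the process $X$ killed, independently of $X$, with probability $1-\alpha$ at each step (so that it is alive at time $n$ with probability $\alpha^n$), where functions on $E$ are extended by $0$ to the cemetery state, and assume that $\sup_n|f(\tilde X_n)|$, $\sup_n|g(\tilde X_n)|$ and $\sup_n|h(\tilde X_n)|$ are integrable under every $\mathbb{P}_x$. Let $\mathcal{T}_i$ be the set of stopping times $\tau$ (with values in $\mathbb{N}_0\cup\{\infty\}$) with respect to the filtration $\sigma(X_0,\dots,X_n,\xi^{(i)}_0,\dots,\xi^{(i)}_n)$, $n\in\mathbb{N}_0$. For $\tau_1\in\mathcal{T}_1$, $\tau_2\in\mathcal{T}_2$ and $\{i,j\}=\{1,2\}$ the expected reward of player $i$ in the symmetric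 Dynkin game is $$J_i(x;\tau_1,\tau_2)=\mathbb{E}_x\big[\alpha^{\tau_i}f(X_{\tau_i})\mathbb{I}_{\{\tau_i<\tau_j\}}+\alpha^{\tau_j}g(X_{\tau_j})\mathbb{I}_{\{\tau_j<\tau_i\}}+\alpha^{\tau_i}h(X_{\tau_i})\mathbb{I}_{\{\tau_i=\tau_j<\infty\}}\big].$$ For measurable $p:E\to[0,1]$ put $\tau^{p}_{(i)}=\inf\{n\in\mathbb{N}_0:p(X_n)\ge\xi^{(i)}_n\}$, with $\inf\emptyset=\infty$. A pair $(p^{(1)},p^{(2)})$ of such functions is a global Markovian equilibrium with values $(V^{(1)},V^{(2)})$ if, for every $x\in E$, the times $\tilde\tau_i=\tau^{p^{(i)}}_{(i)}\in\mathcal{T}_i$ satisfy $J_1(x;\tilde\tau_1,\tilde\tau_2)=\sup_{\tau_1\in\mathcal{T}_1}J_1(x;\tau_1,\tilde\tau_2)$, $J_2(x;\tilde\tau_1,\tilde\tau_2)=\sup_{\tau_2\in\mathcal{T}_2}J_2(x;\tilde\tau_1,\tau_2)$, and $V^{(i)}(x)=J_i(x;\tilde\tau_1,\tilde\tau_2)$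 for $i=1,2$. Suppose $f=h$, and let $$V(x)=\sup_{\tau\in\mathcal{T}_1}\mathbb{E}_x[\alpha^\tau f(X_\tau)],\qquad x\in E,$$ where $\alpha^\tau f(X_\tau)=0$ on $\{\tau=\infty\}$. Then all these expectations are well defined, the supremum is finite, $V$ is measurable, $\Pi V(x)=\int V(y)\,\Pi(x,dy)$ is well defined (the integral converges absolutely) for every $x\in E$, and there is a measurable function $p:E\to[0,1]$ such that, for all $x\in E$, (i) if $\alpha\Pi V(x)=f(x)$ and $g(x)=f(x)$, then $p(x)\in[0,1]$ (arbitrary); (ii) if $\alpha\Pi V(x)=f(x)$ and $g(x)\ne f(x)$, then $p(x)=0$; (iii) if $\alpha\Pi V(x)<f(x)$ and $g(x)>f(x)$, then $p(x)=\dfrac{f(x)-\alpha\Pi V(x)}{g(x)-\alpha\Pi V(x)}$; (iv) if $\alpha\Pi V(x)<f(x)$ and $g(x)\le f(x)$, then $p(x)=1$; (v) if $\alpha\Pi V(x)>f(x)$, then $p(x)=0$. For every such $p$, the pair $(p^{(1)},p^{(2)})$ with $p^{(1)}=p^{(2)}=p$ is a (symmetric) global Markovian equilibrium with values $V^{(1)}=V^{(2)}=V$.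 -/

import Mathlib

open MeasureTheory ProbabilityTheory

namespace DynkinGame

variable {E Ω : Type*} [MeasurableSpace E] [MeasurableSpace Ω]

/-- The information `σ(Y₀, …, Yₙ)` generated by a process `Y` up to time `n`. -/
@[reducible]
def history {F : Type*} [MeasurableSpace F] (Y : ℕ → Ω → F) (n : ℕ) : MeasurableSpace Ω :=
  ⨆ k ≤ n, MeasurableSpace.comap (Y k) inferInstance

/-- The probabilistic setting: under `P x`, the process `X` is a homogeneous Markov process with
kernel `κ` started at `x`; the randomization devices `ξ i n` of the two players (`i : Fin 2`) are
independent, uniformly distributed and independent of `X`; and `ζ` is the time at which the process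
is killed, independently of `X` and with probability `1 - α` at each step, so that the
probability of being still alive at time `n` is `αⁿ`. -/
structure Setting (E Ω : Type*) [MeasurableSpace E] [MeasurableSpace Ω]
    (κ : Kernel E E) (α : ℝ) where
  P : E → Measure Ω
  X : ℕ → Ω → E
  ξ : Fin 2 → ℕ → Ω → ℝ
  ζ : Ω → ℕ∞
  isProbabilityMeasure : ∀ x, IsProbabilityMeasure (P x)
  measurable_X : ∀ n, Measurable (X n)
  measurable_ξ : ∀ i n, Measurable (ξ i n)
  measurable_ζ : Measurable ζ
  /-- `X 0 = x` under `P x`. -/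
  initial : ∀ x, (P x).map (X 0) = Measure.dirac x
  /-- The Markov property: `P x (X (n+1) ∈ B | X 0, …, X n) = κ (X n) B`. -/
  markov : ∀ x n (B : Set E), MeasurableSet B → ∀ A : Set Ω, MeasurableSet[history X n] A →
    P x (A ∩ X (n + 1) ⁻¹' B) = ∫⁻ ω in A, κ (X n ω) B ∂P x
  uniform_ξ : ∀ x i n, (P x).map (ξ i n) = volume.restrict (Set.Icc (0 : ℝ) 1)
  indep_ξ : ∀ x, iIndepFun (fun q : Fin 2 × ℕ => ξ q.1 q.2) (P x)
  indep_X_ξ : ∀ x, IndepFun (fun ω n => X n ω) (fun ω (q : Fin 2 × ℕ) => ξ q.1 q.2 ω) (P x)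
  survival : ∀ x (n : ℕ), P x {ω | (n : ℕ∞) < ζ ω} = ENNReal.ofReal (α ^ n)
  indep_X_ζ : ∀ x, IndepFun (fun ω n => X n ω) ζ (P x)

namespace Setting

variable {κ : Kernel E E} {α : ℝ} (S : Setting E Ω κ α)

/-- The killed process; `none` is the cemetery state. -/
noncomputable def killed (n : ℕ) (ω : Ω) : Option E :=
  if (n : ℕ∞) < S.ζ ω then some (S.X n ω) else none

/-- `sup_n |u(X̃_n)|` is integrable under every `P x`, where `X̃` is the killed process and `u` is
extended by `0` to the cemetery state. -/
def SupIntegrable (u : E → ℝ) : Prop :=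
  ∀ x, ∫⁻ ω, ⨆ n, ‖(S.killed n ω).elim 0 u‖ₑ ∂S.P x < ⊤

/-- The filtration `σ(X₀, …, Xₙ, ξᵢ₀, …, ξᵢₙ)` of player `i`. -/
def playerFiltration (i : Fin 2) :
    Filtration ℕ (inferInstance : MeasurableSpace Ω) where
  seq n := history S.X n ⊔ history (S.ξ i) n
  mono' _ _ hmn := sup_le_sup
    (iSup₂_le fun k hk => le_iSup₂_of_le k (hk.trans hmn) le_rfl)
    (iSup₂_le fun k hk => le_iSup₂_of_le k (hk.trans hmn) le_rfl)
  le' _ := sup_le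
    (iSup₂_le fun k _ => (S.measurable_X k).comap_le)
    (iSup₂_le fun k _ => (S.measurable_ξ i k).comap_le)

/-- The admissible stopping times of player `i`; they may take the value `⊤` (never stop). -/
def admissible (i : Fin 2) : Set (Ω → WithTop ℕ) :=
  {τ | IsStoppingTime (S.playerFiltration i) τ}

/-- The Markovian randomized stopping time `inf {n | ξᵢₙ ≤ p(Xₙ)}` of player `i`. -/
noncomputable def markovTime (i : Fin 2) (p : E → ℝ) (ω : Ω) : WithTop ℕ :=
  sInf {t | ∃ n : ℕ, t = n ∧ S.ξ i n ω ≤ p (S.X n ω)}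

/-- The discounted payoff `α^t u(X_t)`, which is `0` at `t = ∞`. -/
noncomputable def discounted (u : E → ℝ) (t : WithTop ℕ) (ω : Ω) : ℝ :=
  match t with
  | ⊤ => 0
  | (n : ℕ) => α ^ n * u (S.X n ω)

/-- The random payoff of a player with payoff functions `f`, `g`, `h`, who stops at `σ` while the
opponent stops at `τ`: `f` for stopping first, `g` if the opponent stops first, `h` if both stop
simultaneously, and `0` if nobody ever stops. -/
noncomputable def payoff (f g h : E → ℝ) (σ τ : Ω → WithTop ℕ) (ω : Ω) : ℝ :=
  if σ ω < τ ω then S.discounted f (σ ω) ω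
  else if τ ω < σ ω then S.discounted g (τ ω) ω
  else S.discounted h (σ ω) ω

/-- The expected reward of a player who stops at `σ` while the opponent stops at `τ`. -/
noncomputable def J (f g h : E → ℝ) (x : E) (σ τ : Ω → WithTop ℕ) : ℝ :=
  ∫ ω, S.payoff f g h σ τ ω ∂S.P x

/-- `(τ₁, τ₂)` is a Nash equilibrium for `x`; player `i` has payoff functions `f i, g i, h i`. -/
structure IsNash (f g h : Fin 2 → E → ℝ) (x : E) (τ₁ τ₂ : Ω → WithTop ℕ) : Prop where
  admissible₁ : τ₁ ∈ S.admissible 0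
  admissible₂ : τ₂ ∈ S.admissible 1
  optimal₁ : IsLUB ((fun σ => S.J (f 0) (g 0) (h 0) x σ τ₂) '' S.admissible 0)
    (S.J (f 0) (g 0) (h 0) x τ₁ τ₂)
  optimal₂ : IsLUB ((fun σ => S.J (f 1) (g 1) (h 1) x σ τ₁) '' S.admissible 1)
    (S.J (f 1) (g 1) (h 1) x τ₂ τ₁)

/-- The pair of stopping strategies `(p₁, p₂)` is a global Markovian randomized equilibrium with
values `(V₁, V₂)`. -/
structure IsGlobalEquilibrium (f g h : Fin 2 → E → ℝ) (p₁ p₂ : E → ℝ) (V₁ V₂ : E → ℝ) :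
    Prop where
  measurable₁ : Measurable p₁
  measurable₂ : Measurable p₂
  mem_Icc₁ : ∀ x, p₁ x ∈ Set.Icc (0 : ℝ) 1
  mem_Icc₂ : ∀ x, p₂ x ∈ Set.Icc (0 : ℝ) 1
  isNash : ∀ x, S.IsNash f g h x (S.markovTime 0 p₁) (S.markovTime 1 p₂)
  value₁ : ∀ x, V₁ x = S.J (f 0) (g 0) (h 0) x (S.markovTime 0 p₁) (S.markovTime 1 p₂)
  value₂ : ∀ x, V₂ x = S.J (f 1) (g 1) (h 1) x (S.markovTime 1 p₂) (S.markovTime 0 p₁)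

/-- The expected discounted payoffs `E_x[α^τ f(X_τ)]` over the admissible stopping times of the
first player. -/
def stoppingRewards (f : E → ℝ) (x : E) : Set ℝ :=
  (fun τ : Ω → WithTop ℕ => ∫ ω, S.discounted f (τ ω) ω ∂S.P x) '' S.admissible 0

/-- The value of the discounted optimal stopping problem for `f`. -/
noncomputable def stoppingValue (f : E → ℝ) (x : E) : ℝ :=
  sSup (S.stoppingRewards f x)

end Setting

/-- `p : E → [0,1]` is measurable and chosen according to the five cases that compare `f(x)` with
`α κ V(x)` and `g(x)`; if `α κ V(x) = f(x) = g(x)`, then `p(x) ∈ [0,1]` is arbitrary. -/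
structure IsChoice (κ : Kernel E E) (α : ℝ) (f g V p : E → ℝ) : Prop where
  measurable : Measurable p
  mem_Icc : ∀ x, p x ∈ Set.Icc (0 : ℝ) 1
  indifferent : ∀ x, α * ∫ y, V y ∂κ x = f x → g x ≠ f x → p x = 0
  mixing : ∀ x, α * ∫ y, V y ∂κ x < f x → f x < g x →
    p x = (f x - α * ∫ y, V y ∂κ x) / (g x - α * ∫ y, V y ∂κ x)
  stopping : ∀ x, α * ∫ y, V y ∂κ x < f x → g x ≤ f x → p x = 1
  continuing : ∀ x, f x < α * ∫ y, V y ∂κ x → p x = 0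

end DynkinGame

namespace DynkinGame

open Filter Topology ENNReal

namespace Setting

variable {E Ω : Type*} [MeasurableSpace E] [MeasurableSpace Ω] {κ : Kernel E E} {α : ℝ}
  (S : Setting E Ω κ α)

/-! Write `V` for the value of the one-player stopping problem and `c = αΠV`, so that `V = max f c`.
Against an opponent who stops with probability `p`, not stopping now and facing `V` afterwards is
worth `C = p g + (1 - p) c`. The five cases for `p` are exactly what makes `C ≤ V` and `V = p f + (1
- p) C` hold at every state (`IsChoice.continuation`). Where `c < f < g`, the probability `p` solves
`C = f`, so the opponent is indifferent. Since `f = h`, a tie pays the same as stopping first, and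
the opponent's simultaneous decision does not affect the reward for stopping.

A verification argument turns this into an equilibrium. Consider the expected payoff collected
before time `n` plus `αⁿ E[V(X_n); both still playing]`. For any admissible time against `p` this
quantity is nonincreasing in `n`; if the player also uses `p`, it is constant
(`setIntegral_compl_alive_succ`). It starts at `V x`. Letting `n → ∞` gives `J ≤ V`
(`J_le_of_isExcessive`) and `J = V` (`J_eq_of_isExcessive`). Each step combines the independence of
the fresh device at time `n` (`setIntegral_device`) with the Markov property enlarged by all devices
(`setIntegral_next`).

The remainder vanishes because everything is dominated by the potential `∑ αⁿ Πⁿ (|f| + |g|)`, whose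
finiteness follows from the assumption on the killed process (`green_lt_top`). The function `V` is
built as the limit of finite-horizon values. It is identified with the supremum over stopping times
by the same verification against an opponent with `p = 0`. -/

instance (x : E) : IsProbabilityMeasure (S.P x) := S.isProbabilityMeasure x

/-! ### Independence of the path and the randomization devices -/

/-- The independent sources of randomness: the whole path of `X` and the single devices `ξ i n`. -/
@[reducible]
def source : Option (Fin 2 × ℕ) → MeasurableSpace Ω
  | none => MeasurableSpace.comap (fun ω n => S.X n ω) inferInstance
  | some q => MeasurableSpace.comap (S.ξ q.1 q.2) inferInstance

theorem source_le (o : Option (Fin 2 × ℕ)) : S.source o ≤ (inferInstance : MeasurableSpace Ω) := by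
  cases o with
  | none => exact (measurable_pi_lambda _ S.measurable_X).comap_le
  | some q => exact (S.measurable_ξ q.1 q.2).comap_le

theorem comap_X_le_source (n : ℕ) :
    MeasurableSpace.comap (S.X n) inferInstance ≤ S.source none := by
  rintro _ ⟨s, hs, rfl⟩
  exact ⟨(fun y : ℕ → E => y n) ⁻¹' s, measurable_pi_apply n hs, rfl⟩

theorem history_X_le_source (n : ℕ) : history S.X n ≤ S.source none :=
  iSup₂_le fun k _ => S.comap_X_le_source k

/-- The path is independent of the family of all devices, and the devices are independent of each
other. A finite intersection therefore factors first into a path event and a device event, and the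
device event then factors further. -/
theorem iIndep_source (x : E) : iIndep S.source (S.P x) := by
  classical
  have hξ := S.indep_ξ x
  have hX := S.indep_X_ξ x
  rw [iIndepFun_iff_measure_inter_preimage_eq_mul] at hξ
  rw [indepFun_iff_measure_inter_preimage_eq_mul] at hX
  rw [iIndep_iff]
  intro s A hA
  have hsome : ∀ q, ∃ B : Set ℝ, MeasurableSet B ∧
      (some q ∈ s → S.ξ q.1 q.2 ⁻¹' B = A (some q)) := by
    intro q
    by_cases hq : some q ∈ s
    · obtain ⟨B, hB, h⟩ := hA _ hq
      exact ⟨B, hB, fun _ => h⟩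
    -- Indices outside `s` do not enter the intersection, so any set serves here.
    · exact ⟨∅, .empty, fun h => absurd h hq⟩
  choose B hB hBA using hsome
  have hnoise : S.P x (⋂ q ∈ s.eraseNone, S.ξ q.1 q.2 ⁻¹' B q)
      = ∏ q ∈ s.eraseNone, S.P x (A (some q)) := by
    rw [hξ s.eraseNone fun q _ => hB q]
    exact Finset.prod_congr rfl fun q hq => by rw [hBA q (by simpa using hq)]
  have hset : (⋂ q ∈ s.eraseNone, S.ξ q.1 q.2 ⁻¹' B q)
      = (fun ω (q : Fin 2 × ℕ) => S.ξ q.1 q.2 ω) ⁻¹'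
        ⋂ q ∈ s.eraseNone, (fun z : Fin 2 × ℕ → ℝ => z q) ⁻¹' B q := by
    ext ω; simp
  have hset' : MeasurableSet (⋂ q ∈ s.eraseNone, (fun z : Fin 2 × ℕ → ℝ => z q) ⁻¹' B q) :=
    Finset.measurableSet_biInter _ fun q _ => measurable_pi_apply q (hB q)
  by_cases hn : none ∈ s
  · obtain ⟨D, hD, hDA⟩ := hA _ hn
    have h1 : (⋂ o ∈ s, A o) = (fun ω n => S.X n ω) ⁻¹' D ∩
        ⋂ q ∈ s.eraseNone, S.ξ q.1 q.2 ⁻¹' B q := by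
      ext ω
      simp only [Set.mem_iInter, Set.mem_inter_iff, hDA, Finset.mem_eraseNone]
      refine ⟨fun h => ⟨h _ hn, fun q hq => ?_⟩, fun h o ho => ?_⟩
      · rw [hBA q hq]; exact h _ hq
      · cases o with
        | none => exact h.1
        | some q => rw [← hBA q ho]; exact h.2 q ho
    have h2 : s = insert none (s.eraseNone.map Function.Embedding.some) := by
      ext o; cases o <;> simp [hn]
    rw [h1, hset, hX _ _ hD hset', ← hset, hnoise, hDA]
    conv_rhs => rw [h2]
    rw [Finset.prod_insert (by simp), Finset.prod_map]
    rfl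
  · have h1 : (⋂ o ∈ s, A o) = ⋂ q ∈ s.eraseNone, S.ξ q.1 q.2 ⁻¹' B q := by
      ext ω
      simp only [Set.mem_iInter, Finset.mem_eraseNone]
      refine ⟨fun h q hq => ?_, fun h o ho => ?_⟩
      · rw [hBA q hq]; exact h _ hq
      · cases o with
        | none => exact absurd ho hn
        | some q => rw [← hBA q ho]; exact h q ho
    have h2 : s = s.eraseNone.map Function.Embedding.some := by
      ext o; cases o <;> simp [hn]
    rw [h1, hnoise]
    conv_rhs => rw [h2]
    rw [Finset.prod_map]
    rfl

/-- The information in all sources of randomness except the device `ξ q`. -/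
@[reducible]
def others (q : Fin 2 × ℕ) : MeasurableSpace Ω :=
  ⨆ o ∈ ({some q}ᶜ : Set (Option (Fin 2 × ℕ))), S.source o

theorem others_le (q : Fin 2 × ℕ) : S.others q ≤ (inferInstance : MeasurableSpace Ω) :=
  iSup₂_le fun o _ => S.source_le o

theorem source_le_others {q : Fin 2 × ℕ} {o : Option (Fin 2 × ℕ)} (h : o ≠ some q) :
    S.source o ≤ S.others q :=
  le_iSup₂_of_le o h le_rfl

theorem measure_inter_device (x : E) (q : Fin 2 × ℕ) {A : Set Ω}
    (hA : MeasurableSet[S.others q] A) {t : Set ℝ} (ht : MeasurableSet t) :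
    S.P x (A ∩ S.ξ q.1 q.2 ⁻¹' t) = S.P x A * volume.restrict (Set.Icc (0 : ℝ) 1) t := by
  have h := indep_iSup_of_disjoint S.source_le (S.iIndep_source x)
    (S := {some q}ᶜ) (T := {some q}) disjoint_compl_left
  rw [Indep_iff] at h
  have ht' : MeasurableSet[⨆ o ∈ ({some q} : Set (Option (Fin 2 × ℕ))), S.source o]
      (S.ξ q.1 q.2 ⁻¹' t) :=
    le_iSup₂_of_le (f := fun o (_ : o ∈ ({some q} : Set (Option (Fin 2 × ℕ)))) => S.source o)
      (some q) rfl le_rfl _ ⟨t, ht, rfl⟩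
  rw [h A _ hA ht', ← S.uniform_ξ x q.1 q.2,
    Measure.map_apply (S.measurable_ξ _ _) ht]

/-- Both `A` and `X n` are determined by the other sources, so restricting to `A` keeps the device
uniform and independent of `X n`. The product form makes Fubini available. -/
theorem map_restrict_device (x : E) (q : Fin 2 × ℕ) (n : ℕ) {A : Set Ω}
    (hA : MeasurableSet[S.others q] A) :
    ((S.P x).restrict A).map (fun ω => (S.X n ω, S.ξ q.1 q.2 ω))
      = (((S.P x).restrict A).map (S.X n)).prod (volume.restrict (Set.Icc (0 : ℝ) 1)) := by
  refine (Measure.prod_eq fun s t hs ht => ?_).symm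
  have hX := S.measurable_X n
  have hξ := S.measurable_ξ q.1 q.2
  have hs' : MeasurableSet[S.others q] (S.X n ⁻¹' s) :=
    S.source_le_others (by simp) _ (S.comap_X_le_source n _ ⟨s, hs, rfl⟩)
  rw [Measure.map_apply (hX.prodMk hξ) (hs.prod ht), Measure.map_apply hX hs,
    Measure.restrict_apply (hX hs), Measure.restrict_apply (hX.prodMk hξ (hs.prod ht)),
    ← S.measure_inter_device x q (hs'.inter hA) ht]
  congr 1
  ext ω
  simp only [Set.mem_inter_iff, Set.mem_preimage, Set.mem_prod]
  tauto

/-- Given the other sources of randomness, the device `ξ q` is at most `p (X n)` with probability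
`p (X n)`. -/
theorem setIntegral_device (x : E) (q : Fin 2 × ℕ) (n : ℕ) {A : Set Ω}
    (hA : MeasurableSet[S.others q] A) {p : E → ℝ} (hp : Measurable p)
    (hp01 : ∀ y, p y ∈ Set.Icc (0 : ℝ) 1) {w : E → ℝ} (hw : Measurable w)
    (hwi : Integrable (fun ω => w (S.X n ω)) (S.P x)) :
    ∫ ω in A ∩ {ω | S.ξ q.1 q.2 ω ≤ p (S.X n ω)}, w (S.X n ω) ∂S.P x
      = ∫ ω in A, p (S.X n ω) * w (S.X n ω) ∂S.P x := by
  have hX := S.measurable_X n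
  have hξ := S.measurable_ξ q.1 q.2
  have hT : MeasurableSet {z : E × ℝ | z.2 ≤ p z.1} :=
    measurableSet_le measurable_snd (hp.comp measurable_fst)
  set F : E × ℝ → ℝ := {z : E × ℝ | z.2 ≤ p z.1}.indicator (fun z => w z.1) with hF
  have hFm : Measurable F := (hw.comp measurable_fst).indicator hT
  have hset : MeasurableSet {ω | S.ξ q.1 q.2 ω ≤ p (S.X n ω)} := measurableSet_le hξ (hp.comp hX)
  have hint : Integrable w (((S.P x).restrict A).map (S.X n)) := by
    rw [integrable_map_measure hw.aestronglyMeasurable hX.aemeasurable]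
    exact hwi.integrableOn
  have hFi : Integrable F ((((S.P x).restrict A).map (S.X n)).prod
      (volume.restrict (Set.Icc (0 : ℝ) 1))) :=
    (hint.comp_fst _).indicator hT
  calc ∫ ω in A ∩ {ω | S.ξ q.1 q.2 ω ≤ p (S.X n ω)}, w (S.X n ω) ∂S.P x
      = ∫ ω in A, F (S.X n ω, S.ξ q.1 q.2 ω) ∂S.P x := by
        rw [← setIntegral_indicator hset]; rfl
    _ = ∫ z, F z ∂((((S.P x).restrict A).map (S.X n)).prod
          (volume.restrict (Set.Icc (0 : ℝ) 1))) := by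
        rw [← S.map_restrict_device x q n hA, integral_map (hX.prodMk hξ).aemeasurable
          hFm.aestronglyMeasurable]
    _ = ∫ y, p y * w y ∂(((S.P x).restrict A).map (S.X n)) := by
        rw [integral_prod _ hFi]
        congr 1; ext y
        have h1 : (fun t => F (y, t)) = (Set.Iic (p y)).indicator (fun _ => w y) := by
          ext t; simp [hF, Set.indicator_apply]
        -- Only because `p y ≤ 1` does this interval have length `p y`.
        have h2 : Set.Iic (p y) ∩ Set.Icc (0 : ℝ) 1 = Set.Icc 0 (p y) := by
          ext t
          simp only [Set.mem_inter_iff, Set.mem_Iic, Set.mem_Icc]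
          exact ⟨fun h => ⟨h.2.1, h.1⟩, fun h => ⟨h.2, h.1, h.2.trans (hp01 y).2⟩⟩
        rw [h1, integral_indicator measurableSet_Iic, setIntegral_const, measureReal_def,
          Measure.restrict_apply measurableSet_Iic, h2, Real.volume_Icc, sub_zero,
          ENNReal.toReal_ofReal (hp01 y).1, smul_eq_mul]
    _ = ∫ ω in A, p (S.X n ω) * w (S.X n ω) ∂S.P x := by
        exact integral_map hX.aemeasurable (hp.mul hw).aestronglyMeasurable

theorem integrable_mul_of_mem_Icc (x : E) (n : ℕ) {p : E → ℝ} (hp : Measurable p)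
    (hp01 : ∀ y, p y ∈ Set.Icc (0 : ℝ) 1) {w : E → ℝ}
    (hwi : Integrable (fun ω => w (S.X n ω)) (S.P x)) :
    Integrable (fun ω => p (S.X n ω) * w (S.X n ω)) (S.P x) :=
  hwi.bdd_mul (c := 1) (hp.comp (S.measurable_X n)).aestronglyMeasurable
    (ae_of_all _ fun ω => by
      rw [Real.norm_eq_abs, abs_of_nonneg (hp01 _).1]; exact (hp01 _).2)

theorem setIntegral_device_compl (x : E) (q : Fin 2 × ℕ) (n : ℕ) {A : Set Ω}
    (hA : MeasurableSet[S.others q] A) {p : E → ℝ} (hp : Measurable p)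
    (hp01 : ∀ y, p y ∈ Set.Icc (0 : ℝ) 1) {w : E → ℝ} (hw : Measurable w)
    (hwi : Integrable (fun ω => w (S.X n ω)) (S.P x)) :
    ∫ ω in A \ {ω | S.ξ q.1 q.2 ω ≤ p (S.X n ω)}, w (S.X n ω) ∂S.P x
      = ∫ ω in A, (1 - p (S.X n ω)) * w (S.X n ω) ∂S.P x := by
  have hset : MeasurableSet {ω | S.ξ q.1 q.2 ω ≤ p (S.X n ω)} :=
    measurableSet_le (S.measurable_ξ _ _) (hp.comp (S.measurable_X n))
  have h := integral_inter_add_sdiff (s := A) hset hwi.integrableOn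
  rw [S.setIntegral_device x q n hA hp hp01 hw hwi] at h
  have h2 : ∫ ω in A, (1 - p (S.X n ω)) * w (S.X n ω) ∂S.P x
      = ∫ ω in A, w (S.X n ω) ∂S.P x - ∫ ω in A, p (S.X n ω) * w (S.X n ω) ∂S.P x := by
    rw [← integral_sub hwi.integrableOn
      (S.integrable_mul_of_mem_Icc x n hp hp01 hwi).integrableOn]
    congr 1; ext ω; ring
  linarith

/-! ### The Markov property enlarged by the devices -/

/-- The information in all devices. -/
@[reducible]
def devices : MeasurableSpace Ω :=
  ⨆ o ∈ ({none}ᶜ : Set (Option (Fin 2 × ℕ))), S.source o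

theorem devices_le : S.devices ≤ (inferInstance : MeasurableSpace Ω) :=
  iSup₂_le fun o _ => S.source_le o

/-- The information in `X 0, …, X n` and in all devices. -/
@[reducible]
def joint (n : ℕ) : MeasurableSpace Ω :=
  history S.X n ⊔ S.devices

theorem joint_le (n : ℕ) : S.joint n ≤ (inferInstance : MeasurableSpace Ω) :=
  sup_le ((S.history_X_le_source n).trans (S.source_le none))
    S.devices_le

/-- The Markov property is assumed only for events in the history of `X`. For `a ∩ b`, with `a` in
the history and `b` a device event, both sides acquire the factor `P b` by independence. Such sets
form a π-system generating `joint n`, and finite measures agreeing on it coincide. -/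
theorem measure_inter_next [IsMarkovKernel κ] (x : E) (n : ℕ) {A : Set Ω}
    (hA : MeasurableSet[S.joint n] A) {B : Set E} (hB : MeasurableSet B) :
    S.P x (A ∩ S.X (n + 1) ⁻¹' B) = ∫⁻ ω in A, κ (S.X n ω) B ∂S.P x := by
  have hm := S.joint_le n
  have hind := indep_iSup_of_disjoint S.source_le (S.iIndep_source x)
    (S := {none}) (T := {none}ᶜ) disjoint_compl_right
  simp only [Set.mem_singleton_iff, iSup_iSup_eq_left] at hind
  change Indep (S.source none) S.devices (S.P x) at hind
  have hhist : history S.X n ≤ (inferInstance : MeasurableSpace Ω) := le_sup_left.trans hm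
  let μ₁ : Measure Ω := (S.P x).restrict (S.X (n + 1) ⁻¹' B)
  let μ₂ : Measure Ω := (S.P x).withDensity fun ω => κ (S.X n ω) B
  have h1 : ∀ s, MeasurableSet s → μ₁ s = S.P x (s ∩ S.X (n + 1) ⁻¹' B) :=
    fun s hs => Measure.restrict_apply hs
  have h2 : ∀ s, MeasurableSet s → μ₂ s = ∫⁻ ω in s, κ (S.X n ω) B ∂S.P x :=
    fun s hs => withDensity_apply _ hs
  let 𝒞 : Set (Set Ω) := {s | ∃ a b, MeasurableSet[history S.X n] a ∧ MeasurableSet[S.devices] b ∧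
    s = a ∩ b}
  have hgen : S.joint n = MeasurableSpace.generateFrom 𝒞 := by
    apply le_antisymm
    · refine sup_le (fun a ha => ?_) (fun b hb => ?_)
      · exact MeasurableSpace.measurableSet_generateFrom ⟨a, Set.univ, ha, .univ, by simp⟩
      · exact MeasurableSpace.measurableSet_generateFrom ⟨Set.univ, b, .univ, hb, by simp⟩
    · refine MeasurableSpace.generateFrom_le ?_
      rintro _ ⟨a, b, ha, hb, rfl⟩
      have ha' : MeasurableSet[S.joint n] a := le_sup_left (a := history S.X n) _ ha
      have hb' : MeasurableSet[S.joint n] b := le_sup_right (a := history S.X n) _ hb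
      exact ha'.inter hb'
  have hpi : IsPiSystem 𝒞 := by
    rintro _ ⟨a, b, ha, hb, rfl⟩ _ ⟨a', b', ha', hb', rfl⟩ _
    exact ⟨a ∩ a', b ∩ b', ha.inter ha', hb.inter hb', by ext; simp; tauto⟩
  have hrect : ∀ s ∈ 𝒞, μ₁ s = μ₂ s := by
    rintro _ ⟨a, b, ha, hb, rfl⟩
    have ha' := hhist _ ha
    have hb' := S.devices_le _ hb
    rw [h1 _ (ha'.inter hb'), h2 _ (ha'.inter hb')]
    have hXB : MeasurableSet[S.source none] (S.X (n + 1) ⁻¹' B) :=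
      S.comap_X_le_source (n + 1) _ ⟨B, hB, rfl⟩
    have e1 : a ∩ b ∩ S.X (n + 1) ⁻¹' B = (a ∩ S.X (n + 1) ⁻¹' B) ∩ b := by
      ext; simp; tauto
    rw [e1, (Indep_iff _ _ _).1 hind _ _ ((S.history_X_le_source n _ ha).inter hXB) hb,
      S.markov x n B hB a ha]
    have e2 : ∫⁻ ω in a ∩ b, κ (S.X n ω) B ∂S.P x
        = ∫⁻ ω, (a.indicator fun ω => κ (S.X n ω) B) ω * b.indicator (fun _ => 1) ω ∂S.P x := by
      rw [← lintegral_indicator (ha'.inter hb')]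
      congr 1; ext ω
      by_cases h1 : ω ∈ a <;> by_cases h2 : ω ∈ b <;> simp [h1, h2]
    have hsrc : Measurable[S.source none] (a.indicator fun ω => κ (S.X n ω) B) := by
      refine Measurable.indicator ?_ (S.history_X_le_source n _ ha)
      exact (κ.measurable_coe hB).comp
        ((comap_measurable (S.X n)).mono (S.comap_X_le_source n) le_rfl)
    rw [e2, lintegral_mul_eq_lintegral_mul_lintegral_of_independent_measurableSpace
      (S.source_le none) S.devices_le hind hsrc (measurable_const.indicator hb),
      lintegral_indicator ha', lintegral_indicator hb']
    simp
  have : IsFiniteMeasure (μ₁.trim hm) := isFiniteMeasure_trim hm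
  -- Uniqueness concerns measures on the generated σ-algebra itself, hence the trims.
  have heq : μ₁.trim hm = μ₂.trim hm := by
    refine @ext_of_generate_finite Ω (S.joint n) _ _ 𝒞 hgen hpi this (fun s hs => ?_) ?_
    · have hs' : MeasurableSet[S.joint n] s := by
        rw [hgen]; exact MeasurableSpace.measurableSet_generateFrom hs
      rw [trim_measurableSet_eq hm hs', trim_measurableSet_eq hm hs', hrect s hs]
    · rw [trim_measurableSet_eq hm .univ, trim_measurableSet_eq hm .univ]
      exact hrect _ ⟨Set.univ, Set.univ, .univ, .univ, by simp⟩
  rw [← h1 A (hm _ hA), ← h2 A (hm _ hA), ← trim_measurableSet_eq hm hA, heq,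
    trim_measurableSet_eq hm hA]

theorem map_restrict_next [IsMarkovKernel κ] (x : E) (n : ℕ) {A : Set Ω}
    (hA : MeasurableSet[S.joint n] A) :
    ((S.P x).restrict A).map (S.X (n + 1)) = κ ∘ₘ (((S.P x).restrict A).map (S.X n)) := by
  ext B hB
  rw [Measure.map_apply (S.measurable_X _) hB,
    Measure.restrict_apply (S.measurable_X _ hB), Set.inter_comm, S.measure_inter_next x n hA hB,
    Measure.bind_apply hB κ.aemeasurable, lintegral_map (κ.measurable_coe hB) (S.measurable_X n)]

/-- The Markov property for sets depending on the history of `X` and on the devices. -/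
theorem setIntegral_next [IsMarkovKernel κ] (x : E) (n : ℕ) {A : Set Ω}
    (hA : MeasurableSet[S.joint n] A) {u : E → ℝ} (hu : Measurable u)
    (hui : Integrable (fun ω => u (S.X (n + 1) ω)) (S.P x)) :
    ∫ ω in A, u (S.X (n + 1) ω) ∂S.P x = ∫ ω in A, ∫ y, u y ∂κ (S.X n ω) ∂S.P x := by
  have hX := S.measurable_X
  have hint : Integrable u (κ ∘ₘ (((S.P x).restrict A).map (S.X n))) := by
    rw [← S.map_restrict_next x n hA,
      integrable_map_measure hu.aestronglyMeasurable (hX _).aemeasurable]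
    exact hui.integrableOn
  rw [← integral_map (f := u) (hX (n + 1)).aemeasurable hu.aestronglyMeasurable,
    S.map_restrict_next x n hA, ← Measure.snd_compProd, Measure.snd,
    integral_map measurable_snd.aemeasurable hu.aestronglyMeasurable,
    Measure.integral_compProd
      ((Measure.integrable_compProd_snd_iff hu.aestronglyMeasurable).2 hint),
    integral_map (hX n).aemeasurable
      hu.stronglyMeasurable.integral_kernel.aestronglyMeasurable]

theorem lintegral_next [IsMarkovKernel κ] (x : E) (n : ℕ) {w : E → ℝ≥0∞} (hw : Measurable w) :
    ∫⁻ ω, w (S.X (n + 1) ω) ∂S.P x = ∫⁻ ω, ∫⁻ y, w y ∂κ (S.X n ω) ∂S.P x := by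
  have h := S.map_restrict_next x n (A := Set.univ) .univ
  rw [Measure.restrict_univ] at h
  rw [← lintegral_map hw (S.measurable_X _), h, Measure.lintegral_bind κ.aemeasurable
    hw.aemeasurable, lintegral_map hw.lintegral_kernel (S.measurable_X n)]

end Setting

/-! ### The discounted potential and the optimality equation -/

section Green

variable {E : Type*} [MeasurableSpace E] (κ : Kernel E E) (α : ℝ)

/-- The action of a kernel on nonnegative functions. -/
noncomputable def transition (w : E → ℝ≥0∞) (x : E) : ℝ≥0∞ := ∫⁻ y, w y ∂κ x

theorem measurable_transition {w : E → ℝ≥0∞} (hw : Measurable w) : Measurable (transition κ w) :=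
  hw.lintegral_kernel

theorem measurable_iterate_transition {w : E → ℝ≥0∞} (hw : Measurable w) (n : ℕ) :
    Measurable ((transition κ)^[n] w) := by
  induction n generalizing w with
  | zero => exact hw
  | succ n ih => exact ih (measurable_transition κ hw)

/-- The discounted potential `∑ αⁿ κⁿ w`. -/
noncomputable def green (w : E → ℝ≥0∞) (x : E) : ℝ≥0∞ :=
  ∑' n, ENNReal.ofReal α ^ n * (transition κ)^[n] w x

theorem iterate_transition_add {w w' : E → ℝ≥0∞} (hw : Measurable w) (hw' : Measurable w')
    (n : ℕ) (x : E) : (transition κ)^[n] (fun y => w y + w' y) x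
      = (transition κ)^[n] w x + (transition κ)^[n] w' x := by
  induction n generalizing w w' with
  | zero => rfl
  | succ n ih =>
    have h : transition κ (fun y => w y + w' y)
        = fun y => transition κ w y + transition κ w' y := by
      ext y; exact lintegral_add_left hw _
    rw [Function.iterate_succ_apply, h, ih (measurable_transition κ hw)
      (measurable_transition κ hw')]
    rfl

theorem green_add {w w' : E → ℝ≥0∞} (hw : Measurable w) (hw' : Measurable w') (x : E) :
    green κ α (fun y => w y + w' y) x = green κ α w x + green κ α w' x := by
  simp_rw [green, iterate_transition_add κ hw hw', mul_add]
  exact ENNReal.tsum_add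

/-- Splits off the term `n = 0` of the series. It makes the potential a supersolution of the
one-step recursion, which is how it dominates value functions. -/
theorem add_transition_green {w : E → ℝ≥0∞} (hw : Measurable w) (x : E) :
    w x + ENNReal.ofReal α * transition κ (green κ α w) x = green κ α w x := by
  have h : transition κ (green κ α w) x
      = ∑' n, ENNReal.ofReal α ^ n * (transition κ)^[n + 1] w x := by
    unfold transition green
    rw [lintegral_tsum fun n =>
      ((measurable_iterate_transition κ hw n).const_mul _).aemeasurable]
    refine tsum_congr fun n => ?_
    rw [lintegral_const_mul _ (measurable_iterate_transition κ hw n),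
      Function.iterate_succ_apply']
    rfl
  rw [h, ← ENNReal.tsum_mul_left]
  conv_rhs => rw [green, tsum_eq_zero_add' ENNReal.summable]
  simp [pow_succ', mul_assoc]

/-- The values of the optimal stopping problems with finite horizon. -/
noncomputable def horizonValue (f : E → ℝ) : ℕ → E → ℝ≥0∞
  | 0 => 0
  | n + 1 => fun x =>
      max (ENNReal.ofReal (f x)) (ENNReal.ofReal α * transition κ (horizonValue f n) x)

theorem measurable_horizonValue {f : E → ℝ} (hf : Measurable f) (n : ℕ) :
    Measurable (horizonValue κ α f n) := by
  induction n with
  | zero => exact measurable_const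
  | succ n ih => exact hf.ennreal_ofReal.max ((measurable_transition κ ih).const_mul _)

theorem monotone_horizonValue (f : E → ℝ) : Monotone (horizonValue κ α f) := by
  refine monotone_nat_of_le_succ fun n => ?_
  induction n with
  | zero => exact fun x => zero_le
  | succ n ih =>
    intro x
    exact max_le_max le_rfl (mul_le_mul_right (lintegral_mono ih) _)

theorem horizonValue_le_green {f : E → ℝ} (hf : Measurable f) (n : ℕ) (x : E) :
    horizonValue κ α f n x ≤ green κ α (fun y => ‖f y‖ₑ) x := by
  induction n generalizing x with
  | zero => exact zero_le
  | succ n ih =>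
    rw [← add_transition_green κ α hf.enorm]
    refine max_le ?_ ?_
    · exact (Real.ofReal_le_enorm (f x)).trans le_self_add
    · exact (mul_le_mul_right (lintegral_mono ih) _).trans le_add_self

/-- The limit of the values with finite horizon. -/
noncomputable def limitValue (f : E → ℝ) (x : E) : ℝ :=
  (⨆ n, horizonValue κ α f n x).toReal

theorem measurable_limitValue {f : E → ℝ} (hf : Measurable f) :
    Measurable (limitValue κ α f) :=
  (Measurable.iSup fun n => measurable_horizonValue κ α hf n).ennreal_toReal

theorem limitValue_nonneg (f : E → ℝ) (x : E) : 0 ≤ limitValue κ α f x := toReal_nonneg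

variable {κ α} {f : E → ℝ} (hf : Measurable f)
  (hG : ∀ x, green κ α (fun y => ‖f y‖ₑ) x < ∞)

include hf hG

theorem ofReal_limitValue (x : E) :
    ENNReal.ofReal (limitValue κ α f x) = ⨆ n, horizonValue κ α f n x :=
  ENNReal.ofReal_toReal
    ((iSup_le fun n => horizonValue_le_green κ α hf n x).trans_lt (hG x)).ne

theorem enorm_limitValue_le (x : E) :
    ‖limitValue κ α f x‖ₑ ≤ green κ α (fun y => ‖f y‖ₑ) x := by
  rw [Real.enorm_of_nonneg (limitValue_nonneg κ α f x), ofReal_limitValue hf hG]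
  exact iSup_le fun n => horizonValue_le_green κ α hf n x

theorem integrable_limitValue (hα₀ : 0 < α) (x : E) : Integrable (limitValue κ α f) (κ x) := by
  refine ⟨(measurable_limitValue κ α hf).aestronglyMeasurable, ?_⟩
  refine (lintegral_mono (enorm_limitValue_le hf hG)).trans_lt ?_
  have h := (add_transition_green κ α hf.enorm x).trans_lt (hG x)
  exact lt_top_of_mul_ne_top_right (ENNReal.add_lt_top.1 h).2.ne (by simpa using hα₀)

/-- The optimality equation. -/
theorem limitValue_eq (hα₀ : 0 < α) (x : E) :
    limitValue κ α f x = max (f x) (α * ∫ y, limitValue κ α f y ∂κ x) := by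
  have hint : ∫⁻ y, ⨆ n, horizonValue κ α f n y ∂κ x
      = ENNReal.ofReal (∫ y, limitValue κ α f y ∂κ x) := by
    rw [ofReal_integral_eq_lintegral_ofReal (integrable_limitValue hf hG hα₀ x)
      (ae_of_all _ (limitValue_nonneg κ α f))]
    simp_rw [ofReal_limitValue hf hG]
  have h0 : 0 ≤ ∫ y, limitValue κ α f y ∂κ x := integral_nonneg (limitValue_nonneg κ α f)
  -- Shifting the horizon by one leaves the supremum unchanged, and monotone convergence carries the
  -- limit through the kernel.
  have h1 : ⨆ n, horizonValue κ α f n x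
      = max (ENNReal.ofReal (f x))
        (ENNReal.ofReal α * ∫⁻ y, ⨆ n, horizonValue κ α f n y ∂κ x) := by
    have hmono : Monotone fun n => horizonValue κ α f n x :=
      fun _ _ hmn => monotone_horizonValue κ α f hmn x
    rw [← hmono.iSup_nat_add 1,
      lintegral_iSup (measurable_horizonValue κ α hf) (monotone_horizonValue κ α f),
      ENNReal.mul_iSup]
    exact sup_iSup.symm
  -- The horizon values see only the positive part of `f`. This loses nothing, since the other
  -- argument of the maximum is nonnegative.
  rw [limitValue, h1, hint, ← ENNReal.ofReal_mul hα₀.le, ← ENNReal.ofReal_max,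
    ENNReal.toReal_ofReal (le_max_of_le_right (by positivity))]

end Green

/-! ### From the killed process to a finite potential -/

namespace Setting

variable {E Ω : Type*} [MeasurableSpace E] [MeasurableSpace Ω] {κ : Kernel E E} {α : ℝ}
  (S : Setting E Ω κ α)

theorem lintegral_X_zero (x : E) {w : E → ℝ≥0∞} (hw : Measurable w) :
    ∫⁻ ω, w (S.X 0 ω) ∂S.P x = w x := by
  rw [← lintegral_map hw (S.measurable_X 0), S.initial, lintegral_dirac' _ hw]

theorem integral_X_zero (x : E) {w : E → ℝ} (hw : Measurable w) :
    ∫ ω, w (S.X 0 ω) ∂S.P x = w x := by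
  rw [← integral_map (S.measurable_X 0).aemeasurable hw.aestronglyMeasurable, S.initial,
    integral_dirac' _ _ hw.stronglyMeasurable]

/-- Lifetime `k + 1` means that `k` is the last time at which the process is alive. -/
theorem measure_lifetime_eq (hα₀ : 0 < α) (hα₁ : α < 1) (x : E) (k : ℕ) :
    S.P x (S.ζ ⁻¹' {((k + 1 : ℕ) : ℕ∞)}) = ENNReal.ofReal (1 - α) * ENNReal.ofReal α ^ k := by
  have h : S.ζ ⁻¹' {((k + 1 : ℕ) : ℕ∞)}
      = {ω | (k : ℕ∞) < S.ζ ω} \ {ω | ((k + 1 : ℕ) : ℕ∞) < S.ζ ω} := by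
    ext ω
    simp only [Set.mem_preimage, Set.mem_singleton_iff, Set.mem_sdiff, Set.mem_ofPred_eq, not_lt]
    rw [← ENat.add_one_le_iff (ENat.natCast_ne_top k)]
    push_cast
    exact ⟨fun h => ⟨h.ge, h.le⟩, fun h => le_antisymm h.2 h.1⟩
  have hm : MeasurableSet {ω | ((k + 1 : ℕ) : ℕ∞) < S.ζ ω} :=
    S.measurable_ζ (.of_discrete (s := Set.Ioi _))
  have hsub : {ω | ((k + 1 : ℕ) : ℕ∞) < S.ζ ω} ⊆ {ω | (k : ℕ∞) < S.ζ ω} :=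
    fun ω hω => lt_trans (ENat.natCast_lt_natCast.2 (Nat.lt_succ_self k)) hω
  rw [h, measure_sdiff hsub
    hm.nullMeasurableSet (measure_ne_top _ _), S.survival, S.survival,
    ← ENNReal.ofReal_sub _ (by positivity), ← ENNReal.ofReal_pow hα₀.le,
    ← ENNReal.ofReal_mul (by linarith)]
  congr 1; ring

variable [IsMarkovKernel κ]

theorem lintegral_X (x : E) (n : ℕ) {w : E → ℝ≥0∞} (hw : Measurable w) :
    ∫⁻ ω, w (S.X n ω) ∂S.P x = (transition κ)^[n] w x := by
  induction n generalizing w with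
  | zero => exact S.lintegral_X_zero x hw
  | succ n ih => rw [S.lintegral_next x n hw]; exact ih (measurable_transition κ hw)

theorem lintegral_tsum_X (x : E) {w : E → ℝ≥0∞} (hw : Measurable w) :
    ∫⁻ ω, ∑' n, ENNReal.ofReal α ^ n * w (S.X n ω) ∂S.P x = green κ α w x := by
  have hm : ∀ n, Measurable fun ω => w (S.X n ω) := fun n => hw.comp (S.measurable_X n)
  rw [lintegral_tsum fun n => ((hm n).const_mul _).aemeasurable]
  refine tsum_congr fun n => ?_
  rw [← S.lintegral_X x n hw, lintegral_const_mul _ (hm n)]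

/-- The potential seen from time `m` is the tail, from index `m` on, of the series started at `x`.
Hence it tends to zero, and it bounds the remainder in the verification argument. -/
theorem discounted_lintegral_green (x : E) (m : ℕ) {w : E → ℝ≥0∞} (hw : Measurable w) :
    ENNReal.ofReal α ^ m * ∫⁻ ω, green κ α w (S.X m ω) ∂S.P x
      = ∑' n, ENNReal.ofReal α ^ (n + m) * (transition κ)^[n + m] w x := by
  have hm : ∀ n, Measurable fun ω => (transition κ)^[n] w (S.X m ω) :=
    fun n => (measurable_iterate_transition κ hw n).comp (S.measurable_X m)
  unfold green
  rw [lintegral_tsum fun n => ((hm n).const_mul _).aemeasurable, ← ENNReal.tsum_mul_left]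
  refine tsum_congr fun n => ?_
  rw [lintegral_const_mul _ (hm n),
    S.lintegral_X x m (measurable_iterate_transition κ hw n), ← Function.iterate_add_apply,
    add_comm m n, pow_add]
  ring

theorem tendsto_discounted_lintegral_green (x : E) {w : E → ℝ≥0∞} (hw : Measurable w)
    (hG : green κ α w x < ∞) :
    Tendsto (fun m => ENNReal.ofReal α ^ m * ∫⁻ ω, green κ α w (S.X m ω) ∂S.P x) atTop (𝓝 0) := by
  simp_rw [S.discounted_lintegral_green x _ hw]
  exact ENNReal.tendsto_sum_nat_add _ hG.ne

theorem integrable_of_enorm_le_green (hα₀ : 0 < α) (x : E) (m : ℕ) {w : E → ℝ≥0∞}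
    (hw : Measurable w) (hG : green κ α w x < ∞) {u : E → ℝ} (hu : Measurable u)
    (huG : ∀ y, ‖u y‖ₑ ≤ green κ α w y) :
    Integrable (fun ω => u (S.X m ω)) (S.P x) := by
  refine ⟨(hu.comp (S.measurable_X m)).aestronglyMeasurable, ?_⟩
  refine (lintegral_mono fun ω => huG (S.X m ω)).trans_lt ?_
  have h : ENNReal.ofReal α ^ m * ∫⁻ ω, green κ α w (S.X m ω) ∂S.P x < ∞ := by
    rw [S.discounted_lintegral_green x m hw]
    refine (ENNReal.tsum_comp_le_tsum_of_injective (add_left_injective m)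
      fun n => ENNReal.ofReal α ^ n * (transition κ)^[n] w x).trans_lt hG
  exact lt_top_of_mul_ne_top_right h.ne (pow_ne_zero _ (by simpa using hα₀))

/-- On `{ζ = k + 1}` the supremum over the killed path is at least `|u (X k)|`. These events are
disjoint, independent of `X` and of probability `(1 - α) αᵏ`. Summing over `k` bounds `(1 - α)`
times the potential by the expected supremum. -/
theorem green_lt_top (hα₀ : 0 < α) (hα₁ : α < 1) {u : E → ℝ} (hu : Measurable u)
    (hui : S.SupIntegrable u) (x : E) : green κ α (fun y => ‖u y‖ₑ) x < ∞ := by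
  have hD : ∀ k : ℕ, MeasurableSet (S.ζ ⁻¹' {((k + 1 : ℕ) : ℕ∞)}) :=
    fun k => S.measurable_ζ .of_discrete
  have hprod : ∀ k : ℕ, ENNReal.ofReal (1 - α) * (ENNReal.ofReal α ^ k *
      (transition κ)^[k] (fun y => ‖u y‖ₑ) x)
      = ∫⁻ ω in S.ζ ⁻¹' {((k + 1 : ℕ) : ℕ∞)}, ‖u (S.X k ω)‖ₑ ∂S.P x := by
    intro k
    have hI : Measurable (Set.indicator {((k + 1 : ℕ) : ℕ∞)} (fun _ => (1 : ℝ≥0∞))) :=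
      measurable_from_top
    have hind : IndepFun (fun ω => ‖u (S.X k ω)‖ₑ)
        (fun ω => Set.indicator {((k + 1 : ℕ) : ℕ∞)} (fun _ => (1 : ℝ≥0∞)) (S.ζ ω)) (S.P x) :=
      (S.indep_X_ζ x).comp (φ := fun z : ℕ → E => ‖u (z k)‖ₑ)
        (hu.comp (measurable_pi_apply k)).enorm hI
    have h := lintegral_mul_eq_lintegral_mul_lintegral_of_indepFun''
      (hu.comp (S.measurable_X k)).enorm.aemeasurable
      (hI.comp S.measurable_ζ).aemeasurable hind
    have h1 : ∫⁻ ω, Set.indicator {((k + 1 : ℕ) : ℕ∞)} (fun _ => (1 : ℝ≥0∞)) (S.ζ ω) ∂S.P x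
        = ENNReal.ofReal (1 - α) * ENNReal.ofReal α ^ k := by
      rw [← S.measure_lifetime_eq hα₀ hα₁ x k, ← lintegral_indicator_one (hD k)]
      rfl
    rw [← lintegral_indicator (hD k), ← S.lintegral_X x k hu.enorm, ← mul_assoc, ← h1, mul_comm]
    refine h.symm.trans ?_
    congr 1; ext ω
    simp only [Function.comp_apply]
    by_cases hω : S.ζ ω ∈ ({((k + 1 : ℕ) : ℕ∞)} : Set ℕ∞)
    · rw [Set.indicator_of_mem hω, mul_one, Set.indicator_of_mem (Set.mem_preimage.2 hω)]
    · rw [Set.indicator_of_notMem hω, mul_zero, Set.indicator_of_notMem (by exact hω)]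
  have hle : ENNReal.ofReal (1 - α) * green κ α (fun y => ‖u y‖ₑ) x
      ≤ ∫⁻ ω, ⨆ n, ‖(S.killed n ω).elim 0 u‖ₑ ∂S.P x := by
    rw [green, ← ENNReal.tsum_mul_left]
    simp_rw [hprod]
    calc ∑' k : ℕ, ∫⁻ ω in S.ζ ⁻¹' {((k + 1 : ℕ) : ℕ∞)}, ‖u (S.X k ω)‖ₑ ∂S.P x
        ≤ ∑' k : ℕ, ∫⁻ ω in S.ζ ⁻¹' {((k + 1 : ℕ) : ℕ∞)},
            ⨆ n, ‖(S.killed n ω).elim 0 u‖ₑ ∂S.P x := by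
          refine ENNReal.tsum_le_tsum fun k => setLIntegral_mono' (hD k) fun ω hω => ?_
          refine le_iSup_of_le k ?_
          have hk : (k : ℕ∞) < S.ζ ω := by
            rw [show S.ζ ω = ((k + 1 : ℕ) : ℕ∞) from hω]
            exact_mod_cast Nat.lt_succ_self k
          simp [killed, hk]
      _ = ∫⁻ ω in ⋃ k : ℕ, S.ζ ⁻¹' {((k + 1 : ℕ) : ℕ∞)},
            ⨆ n, ‖(S.killed n ω).elim 0 u‖ₑ ∂S.P x := by
          rw [lintegral_iUnion hD]
          intro i j hij
          refine Set.disjoint_left.2 fun ω hi hj => hij ?_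
          have : ((i + 1 : ℕ) : ℕ∞) = ((j + 1 : ℕ) : ℕ∞) := hi.symm.trans hj
          exact Nat.succ_injective (by exact_mod_cast this)
      _ ≤ _ := setLIntegral_le_lintegral _ _
  exact lt_top_of_mul_ne_top_right (hle.trans_lt (hui x)).ne (by simpa using hα₁)

end Setting

/-! ### Stopping times, the surviving event and payoffs -/

namespace Setting

variable {E Ω : Type*} [MeasurableSpace E] [MeasurableSpace Ω] {κ : Kernel E E} {α : ℝ}
  (S : Setting E Ω κ α)

theorem markovTime_le_iff (i : Fin 2) (p : E → ℝ) (ω : Ω) (n : ℕ) :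
    S.markovTime i p ω ≤ n ↔ ∃ k ≤ n, S.ξ i k ω ≤ p (S.X k ω) := by
  unfold markovTime
  constructor
  · intro h
    have hne : {t : WithTop ℕ | ∃ n : ℕ, t = n ∧ S.ξ i n ω ≤ p (S.X n ω)}.Nonempty := by
      by_contra hempty
      rw [Set.not_nonempty_iff_eq_empty.1 hempty, WithTop.sInf_empty] at h
      exact absurd h (by simp)
    obtain ⟨k, hk, hkp⟩ := csInf_mem hne
    rw [hk] at h
    exact ⟨k, by exact_mod_cast h, hkp⟩
  · rintro ⟨k, hk, hkp⟩
    have hmem : (k : WithTop ℕ) ∈ {t : WithTop ℕ | ∃ n : ℕ, t = n ∧ S.ξ i n ω ≤ p (S.X n ω)} :=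
      ⟨k, rfl, hkp⟩
    exact (csInf_le (OrderBot.bddBelow _) hmem).trans (by exact_mod_cast hk)

theorem markovTime_mem_admissible (i : Fin 2) {p : E → ℝ} (hp : Measurable p) :
    S.markovTime i p ∈ S.admissible i := by
  intro n
  have h : {ω | S.markovTime i p ω ≤ n} = ⋃ k ≤ n, {ω | S.ξ i k ω ≤ p (S.X k ω)} := by
    ext ω; simp [markovTime_le_iff]
  change MeasurableSet[S.playerFiltration i n] {ω | S.markovTime i p ω ≤ (n : WithTop ℕ)}
  rw [h]
  refine MeasurableSet.biUnion (Set.to_countable _) fun k (hk : k ≤ n) => ?_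
  have hX : Measurable[S.playerFiltration i n] (S.X k) :=
    (comap_measurable _).mono (le_sup_of_le_left (le_iSup₂_of_le k hk le_rfl)) le_rfl
  have hξ : Measurable[S.playerFiltration i n] (S.ξ i k) :=
    (comap_measurable _).mono (le_sup_of_le_right (le_iSup₂_of_le k hk le_rfl)) le_rfl
  exact measurableSet_le hξ (hp.comp hX)

/-- A player never sees the other player's devices, and by time `m` has not seen their own later
ones. -/
theorem playerFiltration_le_others {i i' : Fin 2} {m n : ℕ} (h : i = i' → m < n) :
    S.playerFiltration i m ≤ S.others (i', n) := by
  refine sup_le ((S.history_X_le_source m).trans (S.source_le_others (by simp)))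
    (iSup₂_le fun k hk => ?_)
  refine S.source_le_others (o := some (i, k)) (fun he => ?_)
  simp only [Option.some.injEq, Prod.mk.injEq] at he
  have := h he.1
  omega

theorem playerFiltration_le_joint (i : Fin 2) (n : ℕ) : S.playerFiltration i n ≤ S.joint n :=
  sup_le le_sup_left ((iSup₂_le fun k _ => le_iSup₂_of_le
    (f := fun o (_ : o ∈ ({none}ᶜ : Set (Option (Fin 2 × ℕ)))) => S.source o)
    (some (i, k)) (by simp) le_rfl).trans le_sup_right)

variable {S} in
theorem measurableSet_lt_time {i : Fin 2} {σ : Ω → WithTop ℕ} (hσ : σ ∈ S.admissible i) (n : ℕ) :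
    MeasurableSet[S.playerFiltration i n] {ω | (n : WithTop ℕ) < σ ω} := by
  have h : {ω | (n : WithTop ℕ) < σ ω} = {ω | σ ω ≤ n}ᶜ := by ext; simp
  rw [h]
  exact (hσ n).compl

theorem natCast_succ_le_iff (n : ℕ) (t : WithTop ℕ) :
    ((n + 1 : ℕ) : WithTop ℕ) ≤ t ↔ (n : WithTop ℕ) < t := by
  cases t with
  | top => simp [WithTop.natCast_lt_top]
  | coe m =>
    change ((n + 1 : ℕ) : WithTop ℕ) ≤ (m : ℕ) ↔ (n : WithTop ℕ) < (m : ℕ)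
    norm_cast

omit [MeasurableSpace Ω] in
theorem measurableSet_le_of_forall_lt {σ : Ω → WithTop ℕ} {n : ℕ} {𝒢 : MeasurableSpace Ω}
    (h : ∀ k < n, MeasurableSet[𝒢] {ω | (k : WithTop ℕ) < σ ω}) :
    MeasurableSet[𝒢] {ω | (n : WithTop ℕ) ≤ σ ω} := by
  cases n with
  | zero => simp
  | succ n =>
    simp_rw [natCast_succ_le_iff]
    exact h n n.lt_succ_self

theorem lt_markovTime_iff (i : Fin 2) (p : E → ℝ) (ω : Ω) (n : ℕ) :
    (n : WithTop ℕ) < S.markovTime i p ω ↔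
      (n : WithTop ℕ) ≤ S.markovTime i p ω ∧ ¬ S.ξ i n ω ≤ p (S.X n ω) := by
  rw [← not_le, markovTime_le_iff]
  cases n with
  | zero => simp
  | succ n =>
    rw [natCast_succ_le_iff, ← not_le, markovTime_le_iff]
    push Not
    simp only [Nat.le_succ_iff, or_imp, forall_and, forall_eq]

/-- The event that nobody has stopped before time `n`. -/
def alive (σ τ : Ω → WithTop ℕ) (n : ℕ) : Set Ω :=
  {ω | (n : WithTop ℕ) ≤ σ ω ∧ (n : WithTop ℕ) ≤ τ ω}

omit [MeasurableSpace Ω] in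
theorem antitone_alive (σ τ : Ω → WithTop ℕ) : Antitone (alive σ τ) := fun m n hmn ω hω =>
  have h : (m : WithTop ℕ) ≤ n := by exact_mod_cast hmn
  ⟨h.trans hω.1, h.trans hω.2⟩

variable {S} in
theorem measurableSet_alive {i j : Fin 2} {σ τ : Ω → WithTop ℕ} (hσ : σ ∈ S.admissible i)
    (hτ : τ ∈ S.admissible j) (n : ℕ) : MeasurableSet (alive σ τ n) :=
  (measurableSet_le_of_forall_lt fun k _ =>
    (S.playerFiltration i).le k _ (measurableSet_lt_time hσ k)).inter
  (measurableSet_le_of_forall_lt fun k _ =>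
    (S.playerFiltration j).le k _ (measurableSet_lt_time hτ k))

theorem measurable_discounted {i : Fin 2} {u : E → ℝ} (hu : Measurable u) {τ : Ω → WithTop ℕ}
    (hτ : τ ∈ S.admissible i) : Measurable fun ω => S.discounted u (τ ω) ω := by
  have h : Measurable fun z : WithTop ℕ × Ω => S.discounted u z.1 z.2 := by
    -- Times take countably many values, so measurability may be checked at each fixed time.
    refine measurable_from_prod_countable_right fun t => ?_
    cases t with
    | top => exact measurable_const
    | coe n => exact (hu.comp (S.measurable_X n)).const_mul _
  exact h.comp ((IsStoppingTime.measurable' hτ).prodMk measurable_id)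

theorem measurable_payoff {i j : Fin 2} {f g h : E → ℝ} (hf : Measurable f) (hg : Measurable g)
    (hh : Measurable h) {σ τ : Ω → WithTop ℕ} (hσ : σ ∈ S.admissible i)
    (hτ : τ ∈ S.admissible j) : Measurable (S.payoff f g h σ τ) := by
  have hσ' := IsStoppingTime.measurable' hσ
  have hτ' := IsStoppingTime.measurable' hτ
  exact Measurable.ite (measurableSet_lt hσ' hτ') (S.measurable_discounted hf hσ)
    (Measurable.ite (measurableSet_lt hτ' hσ') (S.measurable_discounted hg hτ)
      (S.measurable_discounted hh hσ))

/-- The reward at a random time is one term of the sum over all times. The bound is uniform in the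
time, and its expectation is the potential of `w`. -/
theorem enorm_discounted_le (hα₀ : 0 < α) {u : E → ℝ} {w : E → ℝ≥0∞} (huw : ∀ y, ‖u y‖ₑ ≤ w y)
    (t : WithTop ℕ) (ω : Ω) :
    ‖S.discounted u t ω‖ₑ ≤ ∑' n, ENNReal.ofReal α ^ n * w (S.X n ω) := by
  cases t with
  | top => simp [discounted]
  | coe n =>
    refine le_trans ?_ (ENNReal.le_tsum n)
    change ‖α ^ n * u (S.X n ω)‖ₑ ≤ _
    rw [enorm_mul, enorm_pow, Real.enorm_of_nonneg hα₀.le]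
    exact mul_le_mul_right (huw _) _

variable [IsMarkovKernel κ]

theorem integrable_discounted (hα₀ : 0 < α) (x : E) {i : Fin 2} {u : E → ℝ} (hu : Measurable u)
    (hG : green κ α (fun y => ‖u y‖ₑ) x < ∞) {τ : Ω → WithTop ℕ} (hτ : τ ∈ S.admissible i) :
    Integrable (fun ω => S.discounted u (τ ω) ω) (S.P x) := by
  refine ⟨(S.measurable_discounted hu hτ).aestronglyMeasurable, ?_⟩
  refine (lintegral_mono fun ω => S.enorm_discounted_le hα₀ (fun y => le_rfl) _ ω).trans_lt ?_
  rwa [S.lintegral_tsum_X x hu.enorm]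

variable {f g : E → ℝ}

/-- The weight that dominates both payoff functions. -/
noncomputable def weight (f g : E → ℝ) (y : E) : ℝ≥0∞ := ‖f y‖ₑ + ‖g y‖ₑ

theorem measurable_weight (hf : Measurable f) (hg : Measurable g) : Measurable (weight f g) :=
  hf.enorm.add hg.enorm

theorem integrable_payoff (hα₀ : 0 < α) (hf : Measurable f) (hg : Measurable g) (x : E)
    (hG : green κ α (weight f g) x < ∞) {i j : Fin 2} {σ τ : Ω → WithTop ℕ}
    (hσ : σ ∈ S.admissible i) (hτ : τ ∈ S.admissible j) :
    Integrable (S.payoff f g f σ τ) (S.P x) := by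
  refine ⟨(S.measurable_payoff hf hg hf hσ hτ).aestronglyMeasurable, ?_⟩
  refine lt_of_le_of_lt (lintegral_mono (g := fun ω =>
    ∑' n, ENNReal.ofReal α ^ n * weight f g (S.X n ω)) fun ω => ?_) ?_
  · have hfw := S.enorm_discounted_le hα₀ (u := f) (w := weight f g) (fun y => le_self_add)
    have hgw := S.enorm_discounted_le hα₀ (u := g) (w := weight f g) (fun y => le_add_self)
    unfold payoff
    split_ifs
    · exact hfw _ ω
    · exact hgw _ ω
    · exact hfw _ ω
  · rwa [S.lintegral_tsum_X x (measurable_weight hf hg)]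

omit [IsMarkovKernel κ] in
-- Ties need no separate case because the first and third payoff functions are the same `f`.
theorem payoff_of_eq_left {σ τ : Ω → WithTop ℕ} {ω : Ω} {n : ℕ} (h : σ ω = n)
    (h' : (n : WithTop ℕ) ≤ τ ω) : S.payoff f g f σ τ ω = α ^ n * f (S.X n ω) := by
  unfold payoff
  rw [if_neg (c := τ ω < σ ω) (by rw [h]; exact not_lt.2 h'), ite_self, h]
  rfl

omit [IsMarkovKernel κ] in
theorem payoff_of_eq_right {σ τ : Ω → WithTop ℕ} {ω : Ω} {n : ℕ} (h : (n : WithTop ℕ) < σ ω)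
    (h' : τ ω = n) : S.payoff f g f σ τ ω = α ^ n * g (S.X n ω) := by
  unfold payoff
  rw [if_neg (by rw [h']; exact h.not_gt), if_pos (by rwa [h']), h']
  rfl

omit [IsMarkovKernel κ] in
theorem payoff_of_forall_alive {σ τ : Ω → WithTop ℕ} {ω : Ω} (h : ∀ n, ω ∈ alive σ τ n) :
    S.payoff f g f σ τ ω = 0 := by
  have hσ : σ ω = ⊤ := WithTop.eq_top_iff_forall_ge.2 fun n => (h n).1
  have hτ : τ ω = ⊤ := WithTop.eq_top_iff_forall_ge.2 fun n => (h n).2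
  simp [payoff, hσ, hτ, discounted]

end Setting

/-! ### The verification argument -/

namespace Setting

variable {E Ω : Type*} [MeasurableSpace E] [MeasurableSpace Ω] {κ : Kernel E E} {α : ℝ}
  (S : Setting E Ω κ α)

/-- The discounted expectation of `u` after one step. -/
noncomputable def discountedNext (κ : Kernel E E) (α : ℝ) (u : E → ℝ) (y : E) : ℝ :=
  α * ∫ z, u z ∂κ y

theorem measurable_discountedNext [IsMarkovKernel κ] {u : E → ℝ} (hu : Measurable u) :
    Measurable (discountedNext κ α u) :=
  hu.stronglyMeasurable.integral_kernel.measurable.const_mul α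

theorem enorm_discountedNext_le (hα₀ : 0 < α) {w : E → ℝ≥0∞} (hw : Measurable w) {u : E → ℝ}
    (huw : ∀ y, ‖u y‖ₑ ≤ green κ α w y) (y : E) :
    ‖discountedNext κ α u y‖ₑ ≤ green κ α w y := by
  rw [← add_transition_green κ α hw, discountedNext, enorm_mul, Real.enorm_of_nonneg hα₀.le]
  refine le_add_left (mul_le_mul_right ?_ _)
  exact (enorm_integral_le_lintegral_enorm _).trans (lintegral_mono huw)

/-- The reward of a player who does not stop now, when the opponent stops with probability `p` and
the continuation value is `u`. -/
noncomputable def continuation (κ : Kernel E E) (α : ℝ) (g p u : E → ℝ) (y : E) : ℝ :=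
  p y * g y + (1 - p y) * discountedNext κ α u y

variable [IsMarkovKernel κ]

omit [IsMarkovKernel κ] in
theorem integrable_continuation (x : E) (n : ℕ) {g p u : E → ℝ} (hp : Measurable p)
    (hp01 : ∀ y, p y ∈ Set.Icc (0 : ℝ) 1)
    (hgi : Integrable (fun ω => g (S.X n ω)) (S.P x))
    (hci : Integrable (fun ω => discountedNext κ α u (S.X n ω)) (S.P x)) :
    Integrable (fun ω => continuation κ α g p u (S.X n ω)) (S.P x) :=
  (S.integrable_mul_of_mem_Icc x n hp hp01 hgi).add
    (S.integrable_mul_of_mem_Icc x n (p := fun y => 1 - p y) (measurable_const.sub hp)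
      (fun y => ⟨by linarith [(hp01 y).2], by linarith [(hp01 y).1]⟩) hci)

variable {f g p u : E → ℝ} {x : E} {i j : Fin 2} {σ : Ω → WithTop ℕ}

/-- The event that both are still playing and `σ > n` does not involve the device `(j, n)`, so `p (X
n)` may be replaced by the opponent's actual decision at time `n`. If the opponent stops, `g` is
collected; otherwise both survive to `n + 1` and the Markov property applies. -/
theorem setIntegral_continuation (hij : i ≠ j) (hσ : σ ∈ S.admissible i) (hg : Measurable g)
    (hp : Measurable p) (hp01 : ∀ y, p y ∈ Set.Icc (0 : ℝ) 1) (hu : Measurable u) (n : ℕ)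
    (hgi : Integrable (fun ω => g (S.X n ω)) (S.P x))
    (hci : Integrable (fun ω => discountedNext κ α u (S.X n ω)) (S.P x))
    (hui : Integrable (fun ω => u (S.X (n + 1) ω)) (S.P x)) :
    ∫ ω in alive σ (S.markovTime j p) n ∩ {ω | (n : WithTop ℕ) < σ ω},
        continuation κ α g p u (S.X n ω) ∂S.P x
      = ∫ ω in {ω | (n : WithTop ℕ) < σ ω ∧ S.markovTime j p ω = n}, g (S.X n ω) ∂S.P x
        + α * ∫ ω in alive σ (S.markovTime j p) (n + 1), u (S.X (n + 1) ω) ∂S.P x := by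
  have hτ := S.markovTime_mem_admissible j hp
  set B := alive σ (S.markovTime j p) n ∩ {ω | (n : WithTop ℕ) < σ ω} with hB
  have hBo : MeasurableSet[S.others (j, n)] B := by
    have h1 : MeasurableSet[S.others (j, n)] {ω | (n : WithTop ℕ) < σ ω} :=
      S.playerFiltration_le_others (fun h => absurd h hij) _ (measurableSet_lt_time hσ n)
    have h2 : MeasurableSet[S.others (j, n)] {ω | (n : WithTop ℕ) ≤ S.markovTime j p ω} :=
      measurableSet_le_of_forall_lt fun k hk =>
        S.playerFiltration_le_others (fun _ => hk) _ (measurableSet_lt_time hτ k)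
    have h3 : B = {ω | (n : WithTop ℕ) < σ ω} ∩ {ω | (n : WithTop ℕ) ≤ S.markovTime j p ω} := by
      ext ω
      exact ⟨fun h => ⟨h.2, h.1.2⟩, fun h => ⟨⟨h.1.le, h.2⟩, h.1⟩⟩
    rw [h3]
    exact h1.inter h2
  have hhalt : B ∩ {ω | S.ξ (j, n).1 (j, n).2 ω ≤ p (S.X n ω)}
      = {ω | (n : WithTop ℕ) < σ ω ∧ S.markovTime j p ω = n} := by
    ext ω
    have h := S.lt_markovTime_iff j p ω n
    constructor
    · rintro ⟨⟨⟨_, h1⟩, h2⟩, h3⟩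
      refine ⟨h2, h1.antisymm' (not_lt.1 fun hlt => (h.1 hlt).2 h3)⟩
    · rintro ⟨h1, h2⟩
      refine ⟨⟨⟨h1.le, h2.ge⟩, h1⟩, ?_⟩
      by_contra h3
      exact (h.2 ⟨h2.ge, h3⟩).ne' h2
  have hgo : B \ {ω | S.ξ (j, n).1 (j, n).2 ω ≤ p (S.X n ω)}
      = alive σ (S.markovTime j p) (n + 1) := by
    ext ω
    simp only [alive, natCast_succ_le_iff, Set.mem_ofPred_eq, S.lt_markovTime_iff j p ω n, hB,
      Set.mem_sdiff, Set.mem_inter_iff]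
    exact ⟨fun h => ⟨h.1.2, h.1.1.2, h.2⟩, fun h => ⟨⟨⟨h.1.le, h.2.1⟩, h.1⟩, h.2.2⟩⟩
  have hjoint : MeasurableSet[S.joint n] (alive σ (S.markovTime j p) (n + 1)) := by
    have h1 := S.playerFiltration_le_joint i n _ (measurableSet_lt_time hσ n)
    have h2 := S.playerFiltration_le_joint j n _ (measurableSet_lt_time hτ n)
    simp_rw [alive, natCast_succ_le_iff]
    exact h1.inter h2
  unfold continuation
  rw [integral_add (S.integrable_mul_of_mem_Icc x n hp hp01 hgi).integrableOn
    (S.integrable_mul_of_mem_Icc x n (p := fun y => 1 - p y) (measurable_const.sub hp)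
      (fun y => ⟨by linarith [(hp01 y).2], by linarith [(hp01 y).1]⟩) hci).integrableOn,
    ← S.setIntegral_device x (j, n) n hBo hp hp01 hg hgi,
    ← S.setIntegral_device_compl x (j, n) n hBo hp hp01 (measurable_discountedNext hu) hci,
    hhalt, hgo, S.setIntegral_next x n hjoint hu hui, ← integral_const_mul]
  rfl

/-- One step of the game: the reward collected at time `n` plus the continuation value. -/
theorem setIntegral_payoff_step (hij : i ≠ j) (hσ : σ ∈ S.admissible i) (hg : Measurable g)
    (hp : Measurable p) (hp01 : ∀ y, p y ∈ Set.Icc (0 : ℝ) 1) (hu : Measurable u) (n : ℕ)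
    (hgi : Integrable (fun ω => g (S.X n ω)) (S.P x))
    (hci : Integrable (fun ω => discountedNext κ α u (S.X n ω)) (S.P x))
    (hui : Integrable (fun ω => u (S.X (n + 1) ω)) (S.P x))
    (hpay : Integrable (S.payoff f g f σ (S.markovTime j p)) (S.P x)) :
    ∫ ω in alive σ (S.markovTime j p) n \ alive σ (S.markovTime j p) (n + 1),
        S.payoff f g f σ (S.markovTime j p) ω ∂S.P x
      + α ^ (n + 1) * ∫ ω in alive σ (S.markovTime j p) (n + 1), u (S.X (n + 1) ω) ∂S.P x
      = α ^ n * (∫ ω in alive σ (S.markovTime j p) n \ {ω | (n : WithTop ℕ) < σ ω},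
          f (S.X n ω) ∂S.P x
        + ∫ ω in alive σ (S.markovTime j p) n ∩ {ω | (n : WithTop ℕ) < σ ω},
          continuation κ α g p u (S.X n ω) ∂S.P x) := by
  rw [S.setIntegral_continuation hij hσ hg hp hp01 hu n hgi hci hui]
  have hτ := S.markovTime_mem_admissible j hp
  set τ := S.markovTime j p
  have hlt : MeasurableSet {ω | (n : WithTop ℕ) < σ ω} :=
    (S.playerFiltration i).le n _ (measurableSet_lt_time hσ n)
  have hltτ : MeasurableSet {ω | (n : WithTop ℕ) < τ ω} :=
    (S.playerFiltration j).le n _ (measurableSet_lt_time hτ n)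
  have hal := measurableSet_alive hσ hτ n
  have hT : MeasurableSet {ω | (n : WithTop ℕ) < σ ω ∧ τ ω = n} := by
    have h : {ω | (n : WithTop ℕ) < σ ω ∧ τ ω = n}
        = (alive σ τ n ∩ {ω | (n : WithTop ℕ) < σ ω}) \ {ω | (n : WithTop ℕ) < τ ω} := by
      ext ω
      constructor
      · rintro ⟨h1, h2⟩
        exact ⟨⟨⟨h1.le, h2.ge⟩, h1⟩, fun h3 => (ne_of_gt h3) h2⟩
      · rintro ⟨⟨⟨_, h1⟩, h2⟩, h3⟩
        exact ⟨h2, h1.antisymm' (not_lt.1 h3)⟩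
    rw [h]
    exact (hal.inter hlt).diff hltτ
  have hsplit : alive σ τ n \ alive σ τ (n + 1)
      = (alive σ τ n \ {ω | (n : WithTop ℕ) < σ ω})
        ∪ {ω | (n : WithTop ℕ) < σ ω ∧ τ ω = n} := by
    ext ω
    simp only [alive, natCast_succ_le_iff, Set.mem_sdiff, Set.mem_ofPred_eq, Set.mem_union,
      not_and, not_lt]
    constructor
    · rintro ⟨⟨h1, h2⟩, h3⟩
      by_cases h : (n : WithTop ℕ) < σ ω
      · exact Or.inr ⟨h, (h3 h).antisymm h2⟩
      · exact Or.inl ⟨⟨h1, h2⟩, not_lt.1 h⟩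
    · rintro (⟨h1, h2⟩ | ⟨h1, h2⟩)
      · exact ⟨h1, fun h => absurd h (not_lt.2 h2)⟩
      · exact ⟨⟨h1.le, h2.ge⟩, fun _ => h2.le⟩
  have hdisj : Disjoint (alive σ τ n \ {ω | (n : WithTop ℕ) < σ ω})
      {ω | (n : WithTop ℕ) < σ ω ∧ τ ω = n} :=
    Set.disjoint_left.2 fun ω h1 h2 => h1.2 h2.1
  have hleft : ∫ ω in alive σ τ n \ {ω | (n : WithTop ℕ) < σ ω}, S.payoff f g f σ τ ω ∂S.P x
      = α ^ n * ∫ ω in alive σ τ n \ {ω | (n : WithTop ℕ) < σ ω}, f (S.X n ω) ∂S.P x := by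
    rw [← integral_const_mul]
    exact setIntegral_congr_fun (hal.diff hlt) fun ω hω =>
      S.payoff_of_eq_left ((not_lt.1 hω.2).antisymm hω.1.1) hω.1.2
  have hright : ∫ ω in {ω | (n : WithTop ℕ) < σ ω ∧ τ ω = n}, S.payoff f g f σ τ ω ∂S.P x
      = α ^ n * ∫ ω in {ω | (n : WithTop ℕ) < σ ω ∧ τ ω = n}, g (S.X n ω) ∂S.P x := by
    rw [← integral_const_mul]
    exact setIntegral_congr_fun hT fun ω hω => S.payoff_of_eq_right hω.1 hω.2
  rw [hsplit, setIntegral_union hdisj hT hpay.integrableOn hpay.integrableOn, hleft, hright]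
  ring

/-- `u` is an excessive majorant of the stopping problem against an opponent using `p`. -/
structure IsExcessive (κ : Kernel E E) (α : ℝ) (f g p u : E → ℝ) : Prop where
  measurable : Measurable u
  nonneg : ∀ y, 0 ≤ u y
  enorm_le : ∀ y, ‖u y‖ₑ ≤ green κ α (weight f g) y
  stop_le : ∀ y, f y ≤ u y
  continuation_le : ∀ y, continuation κ α g p u y ≤ u y

section

variable (hα₀ : 0 < α) (hij : i ≠ j) (hσ : σ ∈ S.admissible i) (hf : Measurable f)
  (hg : Measurable g) (hG : ∀ y, green κ α (weight f g) y < ∞) (hp : Measurable p)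
  (hp01 : ∀ y, p y ∈ Set.Icc (0 : ℝ) 1) (hu : IsExcessive κ α f g p u)

include hα₀ hf hg hG

theorem integrable_of_enorm_le_weight {v : E → ℝ} (hv : Measurable v)
    (hvG : ∀ y, ‖v y‖ₑ ≤ green κ α (weight f g) y) (n : ℕ) :
    Integrable (fun ω => v (S.X n ω)) (S.P x) :=
  S.integrable_of_enorm_le_green hα₀ x n (measurable_weight hf hg) (hG x) hv hvG

omit [IsMarkovKernel κ] hα₀ hG in
theorem weight_le_green (y : E) : weight f g y ≤ green κ α (weight f g) y := by
  rw [← add_transition_green κ α (measurable_weight hf hg)]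
  exact le_self_add

theorem integrable_first (n : ℕ) : Integrable (fun ω => f (S.X n ω)) (S.P x) :=
  S.integrable_of_enorm_le_weight hα₀ hf hg hG hf
    (fun y => (le_add_right le_rfl).trans (weight_le_green hf hg y)) n

theorem integrable_second (n : ℕ) : Integrable (fun ω => g (S.X n ω)) (S.P x) :=
  S.integrable_of_enorm_le_weight hα₀ hf hg hG hg
    (fun y => (le_add_left le_rfl).trans (weight_le_green hf hg y)) n

include hu

theorem integrable_excessive (n : ℕ) : Integrable (fun ω => u (S.X n ω)) (S.P x) :=
  S.integrable_of_enorm_le_weight hα₀ hf hg hG hu.measurable hu.enorm_le n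

theorem integrable_discountedNext (n : ℕ) :
    Integrable (fun ω => discountedNext κ α u (S.X n ω)) (S.P x) :=
  S.integrable_of_enorm_le_weight hα₀ hf hg hG (measurable_discountedNext hu.measurable)
    (enorm_discountedNext_le hα₀ (measurable_weight hf hg) hu.enorm_le) n

include hp hp01 in
theorem integrable_continuation_excessive (n : ℕ) :
    Integrable (fun ω => continuation κ α g p u (S.X n ω)) (S.P x) :=
  S.integrable_continuation x n hp hp01 (S.integrable_second hα₀ hf hg hG n)
    (S.integrable_discountedNext hα₀ hf hg hG hu n)

theorem tendsto_discounted_alive (τ : Ω → WithTop ℕ) :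
    Tendsto (fun n => α ^ n * ∫ ω in alive σ τ n, u (S.X n ω) ∂S.P x) atTop (𝓝 0) := by
  rw [tendsto_iff_enorm_sub_tendsto_zero]
  refine tendsto_of_tendsto_of_tendsto_of_le_of_le tendsto_const_nhds
    (S.tendsto_discounted_lintegral_green x (measurable_weight hf hg) (hG x))
    (fun _ => zero_le) fun n => ?_
  simp only [sub_zero]
  rw [enorm_mul, enorm_pow, Real.enorm_of_nonneg hα₀.le]
  refine mul_le_mul_right ((enorm_integral_le_lintegral_enorm _).trans
    ((setLIntegral_le_lintegral _ _).trans (lintegral_mono fun ω => hu.enorm_le _))) _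

omit hu in
include hσ in
-- The complements increase to the event that somebody stops; outside it the payoff is zero.
theorem tendsto_setIntegral_payoff {τ : Ω → WithTop ℕ} (hτ : τ ∈ S.admissible j) :
    Tendsto (fun n => ∫ ω in (alive σ τ n)ᶜ, S.payoff f g f σ τ ω ∂S.P x) atTop
      (𝓝 (S.J f g f x σ τ)) := by
  have hpay := S.integrable_payoff hα₀ hf hg x (hG x) hσ hτ
  have h := tendsto_setIntegral_of_monotone (μ := S.P x) (f := S.payoff f g f σ τ)
    (s := fun n => (alive σ τ n)ᶜ) (fun n => (measurableSet_alive hσ hτ n).compl)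
    (fun m n hmn => Set.compl_subset_compl.2 (antitone_alive σ τ hmn)) hpay.integrableOn
  rwa [setIntegral_eq_integral_of_forall_compl_eq_zero fun ω hω =>
    S.payoff_of_forall_alive fun n => by
      by_contra hn
      exact hω (Set.mem_iUnion.2 ⟨n, hn⟩)] at h

include hij hσ hp hp01

theorem setIntegral_compl_alive_succ (n : ℕ) :
    ∫ ω in (alive σ (S.markovTime j p) (n + 1))ᶜ, S.payoff f g f σ (S.markovTime j p) ω ∂S.P x
      + α ^ (n + 1) * ∫ ω in alive σ (S.markovTime j p) (n + 1), u (S.X (n + 1) ω) ∂S.P x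
      = ∫ ω in (alive σ (S.markovTime j p) n)ᶜ, S.payoff f g f σ (S.markovTime j p) ω ∂S.P x
        + α ^ n * (∫ ω in alive σ (S.markovTime j p) n \ {ω | (n : WithTop ℕ) < σ ω},
          f (S.X n ω) ∂S.P x
        + ∫ ω in alive σ (S.markovTime j p) n ∩ {ω | (n : WithTop ℕ) < σ ω},
          continuation κ α g p u (S.X n ω) ∂S.P x) := by
  have hτ := S.markovTime_mem_admissible j hp
  have hpay := S.integrable_payoff hα₀ hf hg x (hG x) hσ hτ
  rw [← S.setIntegral_payoff_step hij hσ hg hp hp01 hu.measurable n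
    (S.integrable_second hα₀ hf hg hG n) (S.integrable_discountedNext hα₀ hf hg hG hu n)
    (S.integrable_excessive hα₀ hf hg hG hu _) hpay]
  set τ := S.markovTime j p
  have hsplit : (alive σ τ (n + 1))ᶜ = (alive σ τ n)ᶜ ∪ (alive σ τ n \ alive σ τ (n + 1)) := by
    ext ω
    have := @antitone_alive Ω σ τ n (n + 1) n.le_succ ω
    simp only [Set.mem_compl_iff, Set.mem_union, Set.mem_sdiff]
    tauto
  have hdisj : Disjoint (alive σ τ n)ᶜ (alive σ τ n \ alive σ τ (n + 1)) :=
    Set.disjoint_left.2 fun ω h1 h2 => h1 h2.1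
  rw [hsplit, setIntegral_union hdisj
    ((measurableSet_alive hσ hτ n).diff (measurableSet_alive hσ hτ (n + 1)))
    hpay.integrableOn hpay.integrableOn]
  ring

/-- No admissible time earns more than an excessive majorant against `p`. -/
theorem J_le_of_isExcessive : S.J f g f x σ (S.markovTime j p) ≤ u x := by
  have hτ := S.markovTime_mem_admissible j hp
  -- The left side is nonincreasing in `n`: where `σ = n` use `f ≤ u`, and where `σ > n` use that
  -- the continuation reward is at most `u`.
  have key : ∀ n : ℕ,
      ∫ ω in (alive σ (S.markovTime j p) n)ᶜ, S.payoff f g f σ (S.markovTime j p) ω ∂S.P x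
        + α ^ n * ∫ ω in alive σ (S.markovTime j p) n, u (S.X n ω) ∂S.P x ≤ u x := by
    intro n
    induction n with
    | zero => simp [alive, S.integral_X_zero x hu.measurable]
    | succ n ih =>
      rw [S.setIntegral_compl_alive_succ hα₀ hij hσ hf hg hG hp hp01 hu n]
      refine le_trans (add_le_add_right (mul_le_mul_of_nonneg_left ?_ (by positivity)) _) ih
      have hlt : MeasurableSet {ω | (n : WithTop ℕ) < σ ω} :=
        (S.playerFiltration i).le n _ (measurableSet_lt_time hσ n)
      have hui := S.integrable_excessive (x := x) hα₀ hf hg hG hu n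
      rw [← integral_inter_add_sdiff (s := alive σ (S.markovTime j p) n) hlt hui.integrableOn,
        add_comm]
      refine add_le_add ?_ ?_
      · exact setIntegral_mono
          (S.integrable_continuation_excessive hα₀ hf hg hG hp hp01 hu n).integrableOn
          hui.integrableOn fun ω => hu.continuation_le _
      · exact setIntegral_mono (S.integrable_first hα₀ hf hg hG n).integrableOn
          hui.integrableOn fun ω => hu.stop_le _
  -- Since `u ≥ 0`, the remainder can be dropped before passing to the limit.
  refine le_of_tendsto (S.tendsto_setIntegral_payoff hα₀ hσ hf hg hG hτ)
    (Eventually.of_forall fun n => le_trans (le_add_of_nonneg_right ?_) (key n))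
  exact mul_nonneg (by positivity) (integral_nonneg fun ω => hu.nonneg _)

omit hσ in
/-- Stopping with probability `q` earns `u` if `u` solves the corresponding equation. -/
theorem J_eq_of_isExcessive {q : E → ℝ} (hq : Measurable q)
    (hq01 : ∀ y, q y ∈ Set.Icc (0 : ℝ) 1)
    (huq : ∀ y, u y = q y * f y + (1 - q y) * continuation κ α g p u y) :
    S.J f g f x (S.markovTime i q) (S.markovTime j p) = u x := by
  have hτ := S.markovTime_mem_admissible j hp
  have hσ := S.markovTime_mem_admissible i hq
  have key : ∀ n : ℕ,
      ∫ ω in (alive (S.markovTime i q) (S.markovTime j p) n)ᶜ,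
          S.payoff f g f (S.markovTime i q) (S.markovTime j p) ω ∂S.P x
        + α ^ n * ∫ ω in alive (S.markovTime i q) (S.markovTime j p) n, u (S.X n ω) ∂S.P x
        = u x := by
    intro n
    induction n with
    | zero => simp [alive, S.integral_X_zero x hu.measurable]
    | succ n ih =>
      rw [S.setIntegral_compl_alive_succ hα₀ hij hσ hf hg hG hp hp01 hu n, ← ih]
      congr 2
      set A := alive (S.markovTime i q) (S.markovTime j p) n with hA
      -- Survival up to time `n` is decided by devices before `n`, so the player's own device at
      -- time `n` is still fresh.
      have hAo : MeasurableSet[S.others (i, n)] A := by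
        have h1 : MeasurableSet[S.others (i, n)] {ω | (n : WithTop ℕ) ≤ S.markovTime i q ω} :=
          measurableSet_le_of_forall_lt fun k hk =>
            S.playerFiltration_le_others (fun _ => hk) _ (measurableSet_lt_time hσ k)
        have h2 : MeasurableSet[S.others (i, n)] {ω | (n : WithTop ℕ) ≤ S.markovTime j p ω} :=
          measurableSet_le_of_forall_lt fun k hk =>
            S.playerFiltration_le_others (fun _ => hk) _ (measurableSet_lt_time hτ k)
        exact h1.inter h2
      have hhalt : A \ {ω | (n : WithTop ℕ) < S.markovTime i q ω}
          = A ∩ {ω | S.ξ (i, n).1 (i, n).2 ω ≤ q (S.X n ω)} := by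
        ext ω
        simp only [Set.mem_sdiff, Set.mem_inter_iff, Set.mem_ofPred_eq,
          S.lt_markovTime_iff i q ω n, not_and, not_not]
        exact ⟨fun h => ⟨h.1, h.2 h.1.1⟩, fun h => ⟨h.1, fun _ => h.2⟩⟩
      have hgo : A ∩ {ω | (n : WithTop ℕ) < S.markovTime i q ω}
          = A \ {ω | S.ξ (i, n).1 (i, n).2 ω ≤ q (S.X n ω)} := by
        ext ω
        simp only [Set.mem_sdiff, Set.mem_inter_iff, Set.mem_ofPred_eq,
          S.lt_markovTime_iff i q ω n]
        exact ⟨fun h => ⟨h.1, h.2.2⟩, fun h => ⟨h.1, h.1.1, h.2⟩⟩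
      have hfi := S.integrable_first (x := x) hα₀ hf hg hG n
      have hCi := S.integrable_continuation_excessive (x := x) hα₀ hf hg hG hp hp01 hu n
      have hC : Measurable (continuation κ α g p u) :=
        (hp.mul hg).add ((measurable_const.sub hp).mul (measurable_discountedNext hu.measurable))
      rw [hhalt, hgo, S.setIntegral_device x (i, n) n hAo hq hq01 hf hfi,
        S.setIntegral_device_compl x (i, n) n hAo hq hq01 hC hCi,
        ← integral_add (S.integrable_mul_of_mem_Icc x n hq hq01 hfi).integrableOn
          (S.integrable_mul_of_mem_Icc x n (p := fun y => 1 - q y) (measurable_const.sub hq)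
            (fun y => ⟨by linarith [(hq01 y).2], by linarith [(hq01 y).1]⟩) hCi).integrableOn]
      congr 1; ext ω
      exact (huq _).symm
  -- For equality, nonnegativity of the remainder is not enough: it has to vanish in the limit.
  have h := (S.tendsto_setIntegral_payoff (x := x) hα₀ hσ hf hg hG hτ).add
    (S.tendsto_discounted_alive (x := x) (σ := S.markovTime i q) hα₀ hf hg hG hu
      (S.markovTime j p))
  simp only [key, add_zero] at h
  exact tendsto_nhds_unique h tendsto_const_nhds

end

end Setting

/-! ### The choice of the stopping probability -/

section Choice

variable {E : Type*} [MeasurableSpace E] {κ : Kernel E E} [IsMarkovKernel κ] {α : ℝ}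
  {f g V : E → ℝ}

theorem exists_isChoice (hf : Measurable f) (hg : Measurable g) (hV : Measurable V) :
    ∃ p : E → ℝ, IsChoice κ α f g V p := by
  classical
  set c : E → ℝ := fun y => α * ∫ z, V z ∂κ y with hc
  have hcm : Measurable c := Setting.measurable_discountedNext hV
  -- The value `0` on `f = c` suits both indifference cases. In the last branch `c < f < g`, so the
  -- quotient is positive and below one.
  refine ⟨fun y => if f y ≤ c y then 0 else if g y ≤ f y then 1
    else (f y - c y) / (g y - c y), ?_, fun y => ?_, ?_, ?_, ?_, ?_⟩
  · exact Measurable.ite (measurableSet_le hf hcm) measurable_const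
      (Measurable.ite (measurableSet_le hg hf) measurable_const ((hf.sub hcm).div (hg.sub hcm)))
  · split_ifs with h1 h2
    · simp
    · simp
    · push Not at h1 h2
      exact ⟨div_nonneg (by linarith) (by linarith), (div_le_one (by linarith)).2 (by linarith)⟩
  · intro y h _
    exact if_pos (h.ge : f y ≤ c y)
  · intro y h1 h2
    exact (if_neg (not_le.2 h1 : ¬ f y ≤ c y)).trans (if_neg (not_le.2 h2))
  · intro y h1 h2
    exact (if_neg (not_le.2 h1 : ¬ f y ≤ c y)).trans (if_pos h2)
  · intro y h
    exact if_pos (h.le : f y ≤ c y)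

omit [IsMarkovKernel κ] in
/-- Against a choice `p`, the optimality equation of `V` holds for every player who continues or
stops with probability `p`. -/
theorem IsChoice.continuation {p : E → ℝ} (hp : IsChoice κ α f g V p)
    (hV : ∀ y, V y = max (f y) (α * ∫ z, V z ∂κ y)) (y : E) :
    Setting.continuation κ α g p V y ≤ V y ∧
      V y = p y * f y + (1 - p y) * Setting.continuation κ α g p V y := by
  have h := hV y
  unfold Setting.continuation Setting.discountedNext
  set c := α * ∫ z, V z ∂κ y with hc
  rcases lt_trichotomy c (f y) with hlt | heq | hgt
  · rw [max_eq_left hlt.le] at h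
    rcases lt_or_ge (f y) (g y) with hg | hg
    · have hne : g y - c ≠ 0 := by linarith
      have hp' : p y * (g y - c) = f y - c := by
        rw [hp.mixing y hlt hg]; exact div_mul_cancel₀ _ hne
      -- The mixing probability makes stopping and continuing equally good.
      have hC : p y * g y + (1 - p y) * c = f y := by linarith
      rw [hC, h]
      exact ⟨le_rfl, by ring⟩
    · rw [hp.stopping y hlt hg, h]
      exact ⟨by linarith, by ring⟩
  · rw [heq, max_self] at h
    -- If `g = f = c`, all rewards coincide and the value of `p y` plays no role.
    by_cases hg : g y = f y
    · rw [heq, hg, h]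
      exact ⟨by linarith, by ring⟩
    · rw [hp.indifferent y heq hg, heq, h]
      exact ⟨by linarith, by ring⟩
  · rw [max_eq_right hgt.le] at h
    rw [hp.continuing y hgt, h]
    exact ⟨by linarith, by ring⟩

end Choice

/-! ### The one-player problem as a game, and the equilibrium -/

namespace Setting

variable {E Ω : Type*} [MeasurableSpace E] [MeasurableSpace Ω] {κ : Kernel E E} {α : ℝ}
  (S : Setting E Ω κ α)

/-- The stopping test is not strict, so `p = 0` still stops when a device equals `0`; this is a null
event. -/
theorem ae_markovTime_zero (x : E) (i : Fin 2) :
    ∀ᵐ ω ∂S.P x, S.markovTime i (fun _ => 0) ω = ⊤ := by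
  have h : ∀ n, ∀ᵐ ω ∂S.P x, ¬ S.ξ i n ω ≤ 0 := by
    intro n
    have hle : MeasurableSet {ω | S.ξ i n ω ≤ 0} :=
      measurableSet_le (S.measurable_ξ i n) measurable_const
    have h0 : S.P x (S.ξ i n ⁻¹' Set.Iic 0) = 0 := by
      rw [← Measure.map_apply (S.measurable_ξ i n) measurableSet_Iic, S.uniform_ξ,
        Measure.restrict_apply measurableSet_Iic]
      refine measure_mono_null (t := {0}) (fun t ht => le_antisymm ht.1 ht.2.1) (by simp)
    exact measure_eq_zero_iff_ae_notMem.1 h0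
  filter_upwards [ae_all_iff.2 h] with ω hω
  refine WithTop.eq_top_iff_forall_gt.2 fun n => ?_
  refine not_le.1 fun hle => ?_
  obtain ⟨k, -, hk⟩ := (S.markovTime_le_iff i (fun _ => 0) ω n).1 hle
  exact hω k hk

/-- Lets the verification argument for the game also solve the optimal stopping problem. -/
theorem J_markovTime_zero (f g : E → ℝ) (x : E) (i : Fin 2) (σ : Ω → WithTop ℕ) :
    S.J f g f x σ (S.markovTime i fun _ => 0) = ∫ ω, S.discounted f (σ ω) ω ∂S.P x := by
  refine integral_congr_ae ?_
  filter_upwards [S.ae_markovTime_zero x i] with ω hω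
  simp [payoff, hω]

variable [IsMarkovKernel κ] {f g : E → ℝ}

theorem green_weight_lt_top (hα₀ : 0 < α) (hα₁ : α < 1) (hf : Measurable f) (hg : Measurable g)
    (hf_int : S.SupIntegrable f) (hg_int : S.SupIntegrable g) (x : E) :
    green κ α (weight f g) x < ∞ := by
  unfold weight
  rw [green_add κ α hf.enorm hg.enorm]
  exact ENNReal.add_lt_top.2 ⟨S.green_lt_top hα₀ hα₁ hf hf_int x,
    S.green_lt_top hα₀ hα₁ hg hg_int x⟩

omit [IsMarkovKernel κ] in
theorem isExcessive_limitValue (hα₀ : 0 < α) (hf : Measurable f) (hg : Measurable g)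
    (hG : ∀ y, green κ α (fun z => ‖f z‖ₑ) y < ∞) {p : E → ℝ}
    (hp : ∀ y, continuation κ α g p (limitValue κ α f) y ≤ limitValue κ α f y) :
    IsExcessive κ α f g p (limitValue κ α f) where
  measurable := measurable_limitValue κ α hf
  nonneg := limitValue_nonneg κ α f
  enorm_le y := by
    unfold weight
    rw [green_add κ α hf.enorm hg.enorm]
    exact le_add_right (enorm_limitValue_le hf hG y)
  stop_le y := by rw [limitValue_eq hf hG hα₀ y]; exact le_max_left _ _
  continuation_le := hp

theorem isGreatest_stoppingRewards (hα₀ : 0 < α) (hα₁ : α < 1) (hf : Measurable f)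
    (hf_int : S.SupIntegrable f) (x : E) :
    IsGreatest (S.stoppingRewards f x) (limitValue κ α f x) := by
  classical
  have hG := S.green_lt_top hα₀ hα₁ hf hf_int
  have hGw := S.green_weight_lt_top hα₀ hα₁ hf hf hf_int hf_int
  have hV : ∀ y, limitValue κ α f y = max (f y) (discountedNext κ α (limitValue κ α f) y) :=
    limitValue_eq hf hG hα₀
  set V := limitValue κ α f with hVdef
  have hcm : Measurable (discountedNext κ α V) :=
    measurable_discountedNext (measurable_limitValue κ α hf)
  have hcont : ∀ y, continuation κ α f (fun _ => 0) V y = discountedNext κ α V y := fun y => by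
    simp [continuation]
  have hexc : IsExcessive κ α f f (fun _ => 0) V :=
    isExcessive_limitValue hα₀ hf hf hG fun y => by
      rw [hcont, ← hVdef, hV]; exact le_max_right _ _
  have h0 : ∀ y : E, (fun _ : E => (0 : ℝ)) y ∈ Set.Icc (0 : ℝ) 1 := fun _ => by simp
  constructor
  -- Up to null events, this is the first entrance into the set where stopping is optimal.
  · set q : E → ℝ := fun y => if discountedNext κ α V y ≤ f y then 1 else 0 with hq
    have hqm : Measurable q :=
      Measurable.ite (measurableSet_le hcm hf) measurable_const measurable_const
    refine ⟨S.markovTime 0 q, S.markovTime_mem_admissible 0 hqm, ?_⟩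
    dsimp only
    rw [← S.J_markovTime_zero f f x 1]
    refine S.J_eq_of_isExcessive hα₀ (by decide) hf hf hGw measurable_const h0 hexc hqm
      (fun y => ?_) fun y => ?_
    · simp only [hq]; split_ifs <;> simp
    · rw [hcont, hV y]
      simp only [hq]
      split_ifs with h
      · rw [max_eq_left h]; ring
      · rw [max_eq_right (not_le.1 h).le]; ring
  · rintro _ ⟨τ, hτ, rfl⟩
    dsimp only
    rw [← S.J_markovTime_zero f f x 1]
    exact S.J_le_of_isExcessive hα₀ (by decide) hτ hf hf hGw measurable_const h0 hexc

/-- The maximum is attained, so the real `sSup` is a genuine supremum and not its default value. -/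
theorem stoppingValue_eq (hα₀ : 0 < α) (hα₁ : α < 1) (hf : Measurable f)
    (hf_int : S.SupIntegrable f) : S.stoppingValue f = limitValue κ α f :=
  funext fun x => (S.isGreatest_stoppingRewards hα₀ hα₁ hf hf_int x).csSup_eq

theorem isGlobalEquilibrium_of_isChoice (hα₀ : 0 < α) (hα₁ : α < 1) (hf : Measurable f)
    (hg : Measurable g) (hf_int : S.SupIntegrable f) (hg_int : S.SupIntegrable g) {p : E → ℝ}
    (hp : IsChoice κ α f g (limitValue κ α f) p) :
    S.IsGlobalEquilibrium (fun _ => f) (fun _ => g) (fun _ => f) p p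
      (limitValue κ α f) (limitValue κ α f) := by
  have hG := S.green_lt_top hα₀ hα₁ hf hf_int
  have hGw := S.green_weight_lt_top hα₀ hα₁ hf hg hf_int hg_int
  have hcont := hp.continuation (limitValue_eq hf hG hα₀)
  have hexc := isExcessive_limitValue hα₀ hf hg hG fun y => (hcont y).1
  have hadm := fun i => S.markovTime_mem_admissible i hp.measurable
  have heq : ∀ x i j, i ≠ j →
      S.J f g f x (S.markovTime i p) (S.markovTime j p) = limitValue κ α f x := fun x i j hij =>
    S.J_eq_of_isExcessive hα₀ hij hf hg hGw hp.measurable hp.mem_Icc hexc hp.measurable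
      hp.mem_Icc fun y => (hcont y).2
  have hlub : ∀ x i j, i ≠ j → IsLUB ((fun σ => S.J f g f x σ (S.markovTime j p)) ''
      S.admissible i) (S.J f g f x (S.markovTime i p) (S.markovTime j p)) := by
    intro x i j hij
    refine IsGreatest.isLUB ⟨⟨_, hadm i, rfl⟩, ?_⟩
    rintro _ ⟨σ, hσ, rfl⟩
    rw [heq x i j hij]
    exact S.J_le_of_isExcessive hα₀ hij hσ hf hg hGw hp.measurable hp.mem_Icc hexc
  exact
    { measurable₁ := hp.measurable
      measurable₂ := hp.measurable
      mem_Icc₁ := hp.mem_Icc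
      mem_Icc₂ := hp.mem_Icc
      isNash := fun x => ⟨hadm 0, hadm 1, hlub x 0 1 (by decide), hlub x 1 0 (by decide)⟩
      value₁ := fun x => (heq x 0 1 (by decide)).symm
      value₂ := fun x => (heq x 1 0 (by decide)).symm }

end Setting

end DynkinGame

theorem mainTheorem6 {E Ω : Type*} [MeasurableSpace E] [MeasurableSpace Ω]
    (κ : ProbabilityTheory.Kernel E E) [ProbabilityTheory.IsMarkovKernel κ]
    (α : ℝ) (hα₀ : 0 < α) (hα₁ : α < 1)
    (S : DynkinGame.Setting E Ω κ α)
    (f g h : E → ℝ) (hf : Measurable f) (hg : Measurable g) (hh : Measurable h)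
    (hf_int : S.SupIntegrable f) (hg_int : S.SupIntegrable g) (hh_int : S.SupIntegrable h)
    (hfh : f = h) :
    -- all expected rewards are well defined
    (∀ x, ∀ τ ∈ S.admissible 0,
      MeasureTheory.Integrable (fun ω => S.discounted f (τ ω) ω) (S.P x)) ∧
    (∀ x, ∀ τ₁ ∈ S.admissible 0, ∀ τ₂ ∈ S.admissible 1,
      MeasureTheory.Integrable (S.payoff f g h τ₁ τ₂) (S.P x) ∧
      MeasureTheory.Integrable (S.payoff f g h τ₂ τ₁) (S.P x)) ∧
    -- the supremum defining the value is finite, and the one-step expectation is well defined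
    (∀ x, IsLUB (S.stoppingRewards f x) (S.stoppingValue f x)) ∧
    Measurable (S.stoppingValue f) ∧
    (∀ x, MeasureTheory.Integrable (S.stoppingValue f) (κ x)) ∧
    -- a choice is possible, and every choice is a symmetric global equilibrium with the value
    (∃ p : E → ℝ, DynkinGame.IsChoice κ α f g (S.stoppingValue f) p) ∧
    (∀ p : E → ℝ, DynkinGame.IsChoice κ α f g (S.stoppingValue f) p →
      S.IsGlobalEquilibrium (fun _ => f) (fun _ => g) (fun _ => h) p p
        (S.stoppingValue f) (S.stoppingValue f)) := by
  subst hfh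
  have hG := S.green_lt_top hα₀ hα₁ hf hf_int
  have hGw := S.green_weight_lt_top hα₀ hα₁ hf hg hf_int hg_int
  refine ⟨fun x τ hτ => S.integrable_discounted hα₀ x hf (hG x) hτ,
    fun x τ₁ h₁ τ₂ h₂ => ⟨S.integrable_payoff hα₀ hf hg x (hGw x) h₁ h₂,
      S.integrable_payoff hα₀ hf hg x (hGw x) h₂ h₁⟩, ?_⟩
  rw [S.stoppingValue_eq hα₀ hα₁ hf hf_int]
  exact ⟨fun x => (S.isGreatest_stoppingRewards hα₀ hα₁ hf hf_int x).isLUB,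
    DynkinGame.measurable_limitValue κ α hf, DynkinGame.integrable_limitValue hf hG hα₀,
    DynkinGame.exists_isChoice hf hg (DynkinGame.measurable_limitValue κ α hf),
    fun p hp => S.isGlobalEquilibrium_of_isChoice hα₀ hα₁ hf hg hf_int hg_int hp⟩
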